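/- Let $\mathcal A_u(B_{c_0})$ be the Banach algebra (with the supremum norm) of uniformly continuous holomorphic functions on the open unit ball $B_{c_0}$ of complex $c_0$, and let $\mathcal M$ be its spectrum, i.e. the set of nonzero continuous homomorphisms $\mathcal A_u(B_{c_0})\to\mathbb C$. For $\varphi,\psi\in\mathcal M$ put $\rho(\varphi,\psi)=\sup\{|\varphi(f)|: \|f\|\le 1,\ \psi(f)=0\}$; the Gleason part of $\varphi$ is $\mathcal{GP}(\varphi)=\{\psi\in\mathcal M:\rho(\varphi,\psi)<1\}$, and the Gleason metric is $\|\varphi-\psi\|$, the norm being that of the dual of the algebra. Every $f\in\mathcal A_u(B_{c_0})$ has a canonical extension $\tilde f$ to the closed unit ball $\overline B_{\ell_\infty}$ of $\ell_\infty=c_0^{**}$: on the open ball $B_{\ell_\infty}$ it is the sum of the Aron–Berner extensions of the Taylor polynomials of $f$ at $0$, and it is uniformly continuous on $\overline B_{\ell_\infty}$. Then $\delta_z(f)=\tilde f(z)$ defines an element $\delta_z\in\mathcal M$ for each $z\in\overline B_{\ell_\infty}$. The open ball $B_{\ell_\infty}$ carries the Gleason metric $\|\delta_u-\delta_v\|$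 of $\mathcal M$, and the polydisc $\mathbb D^k$ (the open unit ball of $\mathbb C^k$ with the maximum norm) carries the Gleason metric of evaluations on $\mathcal A_u(\mathbb D^k)$. Let $z=(z_n)\in\overline B_{\ell_\infty}$, let $\mathbb N_1=\{n:|z_n|=1\}$, and let $\mathbb N\setminus\mathbb N_1=\mathbb N_2\cup\mathbb N_3$ be a disjoint union with $\sup_{n\in\mathbb N_2}|z_n|<1$ (or $\mathbb N_2=\varnothing$) and $\sup_{n\in\mathbb N_3}|z_n|=1$ (or $\mathbb N_3=\varnothing$). Then: (i) If $\mathbb N=\mathbb N_2$, then $z\in B_{\ell_\infty}$ and $\mathcal{GP}(\delta_z)=\mathcal{GP}(\delta_0)=\{\delta_w: w\in B_{\ell_\infty}\}$, and $w\mapsto\delta_w$ is injective on $B_{\ell_\infty}$. (ii) If $\mathbb N=\mathbb N_1$, then $z\in\mathbb T^{\mathbb N}$ and $\mathcal{GP}(\delta_z)=\{\delta_z\}$. (iii) If $\mathbb N_3=\varnothing$ and $\mathbb N_1,\mathbb N_2\ne\varnothing$, then $\mathcal{GP}(\delta_z)=\{\delta_w: w\in\overline B_{\ell_\infty},\ w_n=z_n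 \text{ for } n\in\mathbb N_1,\ \sup_{n\in\mathbb N_2}|w_n|<1\}$. If $\#\mathbb N_2=k$, then replacing the coordinates of $z$ in $\mathbb N_2$ by those of $u\in\mathbb D^k$ (for an enumeration of $\mathbb N_2$) gives a bijection from $\mathbb D^k$ onto $\mathcal{GP}(\delta_z)$ that is isometric for the Gleason metrics. If $\mathbb N_2$ is infinite, the same procedure gives a bijection from $B_{\ell_\infty}$ onto $\mathcal{GP}(\delta_z)$ that is isometric for the Gleason metrics. (iv) If $\mathbb N_3$ is infinite and $\mathbb N_2=\varnothing$, then for every $k\in\mathbb N$ replacing $k$ suitable coordinates of $z$ in $\mathbb N_3$ by those of $u\in\mathbb D^k$ gives an injection of $\mathbb D^k$ into $\mathcal{GP}(\delta_z)$ that is isometric for the Gleason metrics. There is also an injection of $B_{\ell_\infty}$ into $\mathcal{GP}(\delta_z)$ that is continuous from the norm topology to the topology of the Gleason metric. (v) If $\mathbb N_2$ and $\mathbb N_3$ are both infinite, then replacing the coordinates of $z$ in $\mathbb N_2$ by those of $u\in B_{\ell_\infty}$ (for an enumeration of $\mathbb N_2$) gives an injection of $B_{\ell_\infty}$ into $\mathcal{GP}(\delta_z)$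 that is isometric for the Gleason metrics. Moreover, every $z\in\overline B_{\ell_\infty}$ admits a splitting $\mathbb N_2,\mathbb N_3$ as above for which the hypothesis of one of (i)–(v) holds. -/

import Mathlib

open Metric Set Filter Topology WeakDual
open scoped ENNReal ZeroAtInfty BoundedContinuousFunction

noncomputable section

/-! ### The algebra of uniformly continuous holomorphic functions on the open unit ball -/

section Algebra

variable (X : Type*) [NormedAddCommGroup X] [NormedSpace ℂ X]

/-- Extension by zero of a function on the open unit ball of `X`. -/
def zeroExt {X : Type*} [NormedAddCommGroup X] (f : ball (0 : X) 1 → ℂ) : X → ℂ :=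
  open Classical in fun x => if h : x ∈ ball (0 : X) 1 then f ⟨x, h⟩ else 0

/-- A function on the open unit ball is holomorphic if it is complex analytic: near every point of
the ball it is the sum of a convergent power series. -/
def IsHolomorphic {X : Type*} [NormedAddCommGroup X] [NormedSpace ℂ X]
    (f : ball (0 : X) 1 → ℂ) : Prop :=
  AnalyticOnNhd ℂ (zeroExt f) (ball (0 : X) 1)

theorem zeroExt_eq {X : Type*} [NormedAddCommGroup X] (f : ball (0 : X) 1 → ℂ) {x : X}
    (h : x ∈ ball (0 : X) 1) : zeroExt f x = f ⟨x, h⟩ := by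
  simp only [zeroExt, dif_pos h]

/-- `𝒜_u(B_X)` with the supremum norm. (A uniformly continuous function on a ball is bounded, so
working inside the bounded continuous functions is no restriction.) -/
def Au : Subalgebra ℂ (ball (0 : X) 1 →ᵇ ℂ) where
  carrier := {f | UniformContinuous f ∧ IsHolomorphic f}
  mul_mem' := by
    rintro f g ⟨hf, hf'⟩ ⟨hg, hg'⟩
    refine ⟨?_, ?_⟩
    · rw [Metric.uniformContinuous_iff] at hf hg ⊢
      intro ε hε
      have hM : 0 < ‖f‖ + ‖g‖ + 1 := by positivity
      obtain ⟨d₁, hd₁, h₁⟩ := hf (ε / (‖f‖ + ‖g‖ + 1)) (by positivity)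
      obtain ⟨d₂, hd₂, h₂⟩ := hg (ε / (‖f‖ + ‖g‖ + 1)) (by positivity)
      refine ⟨min d₁ d₂, lt_min hd₁ hd₂, ?_⟩
      intro a b hab
      have e₁ := h₁ (lt_of_lt_of_le hab (min_le_left _ _))
      have e₂ := h₂ (lt_of_lt_of_le hab (min_le_right _ _))
      rw [dist_eq_norm] at e₁ e₂ ⊢
      have key : (f * g) a - (f * g) b = f a * (g a - g b) + (f a - f b) * g b := by
        simp only [BoundedContinuousFunction.mul_apply]; ring
      rw [key]
      have n₁ := f.norm_coe_le_norm a
      have n₂ := g.norm_coe_le_norm b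
      calc ‖f a * (g a - g b) + (f a - f b) * g b‖
          ≤ ‖f a‖ * ‖g a - g b‖ + ‖f a - f b‖ * ‖g b‖ := by
            refine (norm_add_le _ _).trans ?_
            rw [norm_mul, norm_mul]
        _ ≤ ‖f‖ * (ε / (‖f‖ + ‖g‖ + 1)) + (ε / (‖f‖ + ‖g‖ + 1)) * ‖g‖ := by
            gcongr
        _ < ε := by
            have : 0 < ε / (‖f‖ + ‖g‖ + 1) := by positivity
            have h3 : ε / (‖f‖ + ‖g‖ + 1) * (‖f‖ + ‖g‖ + 1) = ε := by field_simp
            nlinarith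
    · refine (hf'.mul hg').congr isOpen_ball fun x hx => ?_
      simp [zeroExt_eq _ hx]
  add_mem' := by
    rintro f g ⟨hf, hf'⟩ ⟨hg, hg'⟩
    refine ⟨hf.add hg, (hf'.add hg').congr isOpen_ball fun x hx => ?_⟩
    simp [zeroExt_eq _ hx]
  algebraMap_mem' := by
    intro c
    refine ⟨uniformContinuous_const, (analyticOnNhd_const (v := c)).congr isOpen_ball fun x hx => ?_⟩
    rw [zeroExt_eq _ hx]
    rfl

/-- Evaluation at a point of the open unit ball of `X`, as an element of the spectrum of
`𝒜_u(B_X)`. -/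
def evalChar (x : ball (0 : X) 1) : characterSpace ℂ (Au X) :=
  ⟨StrongDual.toWeakDual
      ((BoundedContinuousFunction.evalCLM ℂ x).comp (Au X).toSubmodule.subtypeL), by
    constructor
    · intro h
      have h1 := DFunLike.congr_fun h (1 : Au X)
      exact one_ne_zero (α := ℂ) h1
    · intro f g
      rfl⟩

end Algebra

/-! ### Gleason parts -/

section Gleason

variable {A : Type*} [NormedRing A] [NormedAlgebra ℂ A]

/-- The pseudo-hyperbolic distance on the spectrum. -/
def pseudoHyp (φ ψ : characterSpace ℂ A) : ℝ :=
  sSup {t : ℝ | ∃ f : A, ‖f‖ ≤ 1 ∧ ψ f = 0 ∧ t = ‖φ f‖}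

/-- The Gleason part of `φ`. -/
def gleasonPart (φ : characterSpace ℂ A) : Set (characterSpace ℂ A) :=
  {ψ | pseudoHyp φ ψ < 1}

/-- A character regarded as an element of the normed dual. -/
def toDual (φ : characterSpace ℂ A) : StrongDual ℂ A :=
  WeakDual.toStrongDual (φ : WeakDual ℂ A)

/-- The Gleason metric on the spectrum: the distance of the norm of the dual. -/
def gleasonDist (φ ψ : characterSpace ℂ A) : ℝ :=
  ‖toDual φ - toDual ψ‖

end Gleason

/-! ### The canonical extension to the bidual -/

section Extension

variable {X : Type*} [NormedAddCommGroup X] [NormedSpace ℂ X]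

/-- For `ζ` in the bidual of `X`, the value at `(ζ, …, ζ)` of the Aron–Berner extension of a
continuous `m`-linear form `a` on `X`. The variables are extended one at a time: the value for an
`(m+1)`-linear form `a` is obtained by applying `ζ` to the functional that sends `x` to the value
for the `m`-linear form `a (x, ⋯)`. -/
def aronBerner (ζ : StrongDual ℂ (StrongDual ℂ X)) :
    (m : ℕ) → StrongDual ℂ (ContinuousMultilinearMap ℂ (fun _ : Fin m => X) ℂ)
  | 0 => ContinuousMultilinearMap.apply ℂ (fun _ : Fin 0 => X) ℂ 0
  | m + 1 =>
    (ζ.comp (ContinuousLinearMap.compL ℂ X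
        (ContinuousMultilinearMap ℂ (fun _ : Fin m => X) ℂ) ℂ (aronBerner ζ m))).comp
      (continuousMultilinearCurryLeftEquiv ℂ (fun _ : Fin (m + 1) => X)
        ℂ).toContinuousLinearEquiv.toContinuousLinearMap

theorem aronBerner_succ (ζ : StrongDual ℂ (StrongDual ℂ X)) (m : ℕ)
    (a : ContinuousMultilinearMap ℂ (fun _ : Fin (m + 1) => X) ℂ) :
    aronBerner ζ (m + 1) a = ζ ((aronBerner ζ m).comp a.curryLeft) := rfl

/-- The extension to the bidual, at the point `ζ`, of the `m`-th Taylor polynomial (at the origin)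
of a function on the unit ball. -/
def taylorExt (f : ball (0 : X) 1 → ℂ) (ζ : StrongDual ℂ (StrongDual ℂ X)) (m : ℕ) : ℂ :=
  (Nat.factorial m : ℂ)⁻¹ * aronBerner ζ m (iteratedFDeriv ℂ m (zeroExt f) 0)

end Extension

/-! ### Sequence spaces -/

/-- The Banach space `c₀` of complex null sequences. -/
abbrev CZero : Type := C₀(ℕ, ℂ)

/-- The Banach space `ℓ_∞` of bounded complex sequences. -/
abbrev LInf : Type := lp (fun _ : ℕ => ℂ) ∞

/-- The unit vectors of `c₀`. -/
def unitVec (n : ℕ) : CZero where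
  toFun := Pi.single n 1
  continuous_toFun := continuous_of_discreteTopology
  zero_at_infty' := by
    rw [Filter.cocompact_eq_cofinite]
    refine tendsto_const_nhds.congr' ?_
    have : {n}ᶜ ∈ (Filter.cofinite : Filter ℕ) := (Set.finite_singleton n).compl_mem_cofinite
    filter_upwards [this] with k hk
    rw [Pi.single_eq_of_ne hk]

theorem sum_norm_unitVec_le (φ : StrongDual ℂ CZero) (s : Finset ℕ) :
    ∑ n ∈ s, ‖φ (unitVec n)‖ ≤ ‖φ‖ := by
  let c : ℕ → ℂ := fun n => star (φ (unitVec n)) / (‖φ (unitVec n)‖ : ℂ)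
  have hc : ∀ n, ‖c n‖ ≤ 1 := by
    intro n
    simp only [c, norm_div, norm_star, Complex.norm_real, norm_norm]
    exact div_self_le_one _
  have hcφ : ∀ n, c n * φ (unitVec n) = (‖φ (unitVec n)‖ : ℂ) := by
    intro n
    by_cases h : φ (unitVec n) = 0
    · simp [c, h]
    · have h' : (‖φ (unitVec n)‖ : ℂ) ≠ 0 := by simpa using h
      have := Complex.conj_mul' (φ (unitVec n))
      simp only [c, Complex.star_def, div_mul_eq_mul_div]
      rw [this, sq, mul_div_assoc, div_self h', mul_one]
  have hx : ‖∑ n ∈ s, c n • unitVec n‖ ≤ 1 := by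
    rw [← ZeroAtInftyContinuousMap.norm_toBCF_eq_norm,
      BoundedContinuousFunction.norm_le zero_le_one]
    intro k
    have : (∑ n ∈ s, c n • unitVec n).toBCF k = ∑ n ∈ s, c n * (Pi.single n (1 : ℂ) : ℕ → ℂ) k := by
      change (∑ n ∈ s, c n • unitVec n) k = _
      induction s using Finset.cons_induction with
      | empty => simp
      | cons a s ha ih =>
        rw [Finset.sum_cons, Finset.sum_cons, ZeroAtInftyContinuousMap.add_apply, ih]
        rfl
    rw [this]
    simp only [Pi.single_apply, mul_ite, mul_one, mul_zero, Finset.sum_ite_eq]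
    split_ifs
    · exact hc k
    · simp
  have h1 : φ (∑ n ∈ s, c n • unitVec n) = ((∑ n ∈ s, ‖φ (unitVec n)‖ : ℝ) : ℂ) := by
    rw [map_sum]
    push_cast
    exact Finset.sum_congr rfl fun n _ => by rw [map_smul, smul_eq_mul, hcφ]
  have h2 : ‖((∑ n ∈ s, ‖φ (unitVec n)‖ : ℝ) : ℂ)‖ = ∑ n ∈ s, ‖φ (unitVec n)‖ := by
    rw [Complex.norm_real, Real.norm_of_nonneg (Finset.sum_nonneg fun _ _ => norm_nonneg _)]
  rw [← h2, ← h1]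
  exact (φ.le_opNorm _).trans (mul_le_of_le_one_right (norm_nonneg _) hx)

theorem summable_norm_unitVec (φ : StrongDual ℂ CZero) :
    Summable fun n => ‖φ (unitVec n)‖ :=
  summable_of_sum_le (fun _ => norm_nonneg _) (sum_norm_unitVec_le φ)

theorem norm_mul_unitVec_le (z : LInf) (φ : StrongDual ℂ CZero) (n : ℕ) :
    ‖z n * φ (unitVec n)‖ ≤ ‖z‖ * ‖φ (unitVec n)‖ := by
  rw [norm_mul]
  exact mul_le_mul_of_nonneg_right (lp.norm_apply_le_norm ENNReal.top_ne_zero z n) (norm_nonneg _)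

theorem summable_mul_unitVec (z : LInf) (φ : StrongDual ℂ CZero) :
    Summable fun n => z n * φ (unitVec n) :=
  Summable.of_norm_bounded ((summable_norm_unitVec φ).mul_left ‖z‖) (norm_mul_unitVec_le z φ)

/-- The canonical identification of `ℓ_∞` with the bidual of `c₀`: the sequence `z` acts on the
functional `φ` as `∑ₙ zₙ φ(eₙ)`. -/
def toBidual (z : LInf) : StrongDual ℂ (StrongDual ℂ CZero) :=
  LinearMap.mkContinuous
    { toFun := fun φ : StrongDual ℂ CZero => ∑' n, z n * φ (unitVec n)
      map_add' := fun φ ψ => by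
        rw [← (summable_mul_unitVec z φ).tsum_add (summable_mul_unitVec z ψ)]
        exact tsum_congr fun n => by rw [_root_.add_apply, mul_add]
      map_smul' := fun c φ => by
        rw [RingHom.id_apply, smul_eq_mul, ← tsum_mul_left]
        exact tsum_congr fun n => by
          rw [_root_.smul_apply, smul_eq_mul]; ring }
    ‖z‖
    (fun φ => by
      have hs := (summable_norm_unitVec φ).mul_left ‖z‖
      refine (tsum_of_norm_bounded hs.hasSum (norm_mul_unitVec_le z φ)).trans ?_
      rw [tsum_mul_left]
      exact mul_le_mul_of_nonneg_left
        ((summable_norm_unitVec φ).tsum_le_of_sum_le (sum_norm_unitVec_le φ)) (norm_nonneg _))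

/-! ### Point evaluations at the closed ball of `ℓ_∞` -/

/-- The spectrum of `𝒜_u(B_{c₀})`. -/
abbrev SpecC0 : Type := characterSpace ℂ (Au CZero)

/-- The closed unit ball of `ℓ_∞`. -/
abbrev ClosedBallLInf : Type := closedBall (0 : LInf) 1

/-- The open unit ball of `ℓ_∞`. -/
abbrev OpenBallLInf : Type := ball (0 : LInf) 1

/-- The open polydisc `𝔻ᵏ`, that is, the open unit ball of `ℂᵏ` with the maximum norm. -/
abbrev Polydisc (k : ℕ) : Type := ball (0 : Fin k → ℂ) 1

/-- A point of the open ball of `ℓ_∞` as a point of the closed ball. -/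
def OpenBallLInf.toClosed (w : OpenBallLInf) : ClosedBallLInf :=
  ⟨w.1, ball_subset_closedBall w.2⟩

/-- `δ z` is, for each `z` in the closed unit ball of `ℓ_∞`, the character `f ↦ f̃(z)` of
`𝒜_u(B_{c₀})`, where `f̃` is the canonical extension of `f`: inside the open unit ball `f̃` is the
sum of the Aron–Berner extensions of the Taylor polynomials of `f`, and `f̃` is uniformly continuous
up to the closed unit ball. These two conditions determine `δ`. -/
def IsPointEvaluation (δ : ClosedBallLInf → SpecC0) : Prop :=
  ∀ f : Au CZero,
    (UniformContinuous fun z : ClosedBallLInf => δ z f) ∧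
    ∀ w : OpenBallLInf, HasSum (taylorExt f.1 (toBidual w.1)) (δ w.toClosed f)

/-! ### Splitting the coordinates -/

/-- The set `ℕ₁` of the coordinates of modulus one. -/
def unimodularIdx (z : ClosedBallLInf) : Set ℕ := {n | ‖z.1 n‖ = 1}

/-- `N₂` and `N₃` are disjoint with union the complement of `ℕ₁`, the supremum of `|zₙ|` over `N₂`
is smaller than one (or `N₂` is empty), and the supremum of `|zₙ|` over `N₃` is one (or `N₃` is
empty). -/
structure IsSplitting (z : ClosedBallLInf) (N₂ N₃ : Set ℕ) : Prop where
  disjoint : Disjoint N₂ N₃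
  union : N₂ ∪ N₃ = (unimodularIdx z)ᶜ
  sup_lt : ∃ r : ℝ, r < 1 ∧ ∀ n ∈ N₂, ‖z.1 n‖ ≤ r
  sup_eq : N₃.Nonempty → IsLUB ((fun n => ‖z.1 n‖) '' N₃) 1

end

/-! The spectrum is identified with the closed ball of `ℓ_∞`, and the Gleason parts are then read
off from a Schwarz–Pick inequality in each coordinate.

The identification rests on the density of the polynomials in the coordinates
(`exists_coordPoly_norm_sub_le`), so that a character is determined by its values on the coordinate
functionals. Dilation and Taylor expansion reduce density to `tendsto_truncL`: a continuous
multilinear form on `c₀` is the norm limit of its truncations to finitely many coordinates. This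
goes by induction on the degree. A form of degree `m + 1` is an operator `T` from `c₀` to the
`m`-linear forms; if its tails were not small, a gliding hump would produce blocks `v j` with `T (v
j)` bounded below. But `T (v j)` are the Fourier coefficients of a bounded, strongly measurable
function with values in the `m`-linear forms, hence tend to zero by the Riemann–Lebesgue lemma. The
same approximation computes the Aron–Berner extension as a limit of values at truncated sequences,
which shows that `pointEval` is the required `δ`.

For the Gleason parts, `pseudoHyp_pointEval_le` joins two points by a disc that is a Möbius disc in
each coordinate and applies the Schwarz lemma. Conversely, `schwarzPick_of_pseudoHyp_lt_one` tests
with functions of one coordinate: Möbius maps, or peaking functions at unimodular coordinates. Being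
in one part thus means that a single constant below 1 serves in all coordinates, which gives
`gleasonPart_pointEval` and so (i)–(iii).

The isometries come from two inequalities. Replacing coordinates turns polynomials into functions of
the new variables without increasing the norm (`gleasonDist_pointEval_le`), and functions of the new
variables lift to `c₀` by composition with a restriction of coordinates (`gleasonDist_le_of_lift`).
The embedding of the ball in (iv) moves each coordinate by a fixed fraction of its distance to the
circle; affine discs show that it is Lipschitz. -/

noncomputable section

/-! ### Spaces with a basis of `c₀` type -/

section CZeroBasis

variable {X : Type*} [NormedAddCommGroup X] [NormedSpace ℂ X]

/-- The vectors `e` and the coordinate functionals `ℓ` identify `X` with a space of null sequences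
that carries the supremum norm. -/
structure IsCZeroBasis (e : ℕ → X) (ℓ : ℕ → StrongDual ℂ X) : Prop where
  coord_unit : ∀ i j, ℓ i (e j) = if i = j then 1 else 0
  norm_coord_le : ∀ i x, ‖ℓ i x‖ ≤ ‖x‖
  norm_le : ∀ (x : X) (C : ℝ), 0 ≤ C → (∀ i, ‖ℓ i x‖ ≤ C) → ‖x‖ ≤ C
  tendsto_coord : ∀ x, Tendsto (fun i => ℓ i x) atTop (𝓝 0)

/-- The vector with the first `n` coordinates of a given sequence. -/
def seqTrunc (e : ℕ → X) (n : ℕ) (z : ℕ → ℂ) : X := ∑ i ∈ Finset.range n, z i • e i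

/-- The projection onto the span of the first `n` basis vectors. -/
def basisProj (e : ℕ → X) (ℓ : ℕ → StrongDual ℂ X) (n : ℕ) : X →L[ℂ] X :=
  ∑ i ∈ Finset.range n, (ℓ i).smulRight (e i)

theorem basisProj_apply (e : ℕ → X) (ℓ : ℕ → StrongDual ℂ X) (n : ℕ) (x : X) :
    basisProj e ℓ n x = seqTrunc e n fun i => ℓ i x := by
  simp [basisProj, seqTrunc]

variable {e : ℕ → X} {ℓ : ℕ → StrongDual ℂ X}

namespace IsCZeroBasis

theorem ext (H : IsCZeroBasis e ℓ) {x y : X} (h : ∀ i, ℓ i x = ℓ i y) : x = y := by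
  rw [← sub_eq_zero, ← norm_le_zero_iff]
  exact H.norm_le _ 0 le_rfl fun i => by simp [h i]

theorem coord_seqTrunc (H : IsCZeroBasis e ℓ) (n : ℕ) (z : ℕ → ℂ) (k : ℕ) :
    ℓ k (seqTrunc e n z) = if k < n then z k else 0 := by
  simp [seqTrunc, H.coord_unit]

theorem norm_seqTrunc_le (H : IsCZeroBasis e ℓ) {z : ℕ → ℂ} {C : ℝ} (hC : 0 ≤ C)
    (h : ∀ k, ‖z k‖ ≤ C) (n : ℕ) : ‖seqTrunc e n z‖ ≤ C := by
  refine H.norm_le _ _ hC fun k => ?_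
  rw [H.coord_seqTrunc]
  split_ifs
  · exact h k
  · simpa using hC

theorem coord_basisProj (H : IsCZeroBasis e ℓ) (n : ℕ) (x : X) (k : ℕ) :
    ℓ k (basisProj e ℓ n x) = if k < n then ℓ k x else 0 := by
  rw [basisProj_apply, H.coord_seqTrunc]

theorem norm_basisProj_apply_le (H : IsCZeroBasis e ℓ) (n : ℕ) (x : X) :
    ‖basisProj e ℓ n x‖ ≤ ‖x‖ := by
  rw [basisProj_apply]
  exact H.norm_seqTrunc_le (norm_nonneg _) (fun k => H.norm_coord_le k x) n

theorem norm_sub_basisProj_apply_le (H : IsCZeroBasis e ℓ) (n : ℕ) (x : X) :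
    ‖x - basisProj e ℓ n x‖ ≤ ‖x‖ := by
  refine H.norm_le _ _ (norm_nonneg _) fun k => ?_
  rw [map_sub, H.coord_basisProj]
  split_ifs
  · simp
  · simpa using H.norm_coord_le k x

theorem tendsto_basisProj (H : IsCZeroBasis e ℓ) (x : X) :
    Tendsto (fun n => basisProj e ℓ n x) atTop (𝓝 x) := by
  rw [Metric.tendsto_atTop]
  intro ε hε
  obtain ⟨N, hN⟩ := (Metric.tendsto_atTop.1 (H.tendsto_coord x)) (ε / 2) (half_pos hε)
  refine ⟨N, fun n hn => ?_⟩
  rw [dist_eq_norm]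
  refine lt_of_le_of_lt (H.norm_le _ _ (half_pos hε).le fun k => ?_) (half_lt_self hε)
  rw [map_sub, H.coord_basisProj]
  split_ifs with hk
  · simpa using (half_pos hε).le
  · have := hN k (by omega)
    rw [dist_zero_right] at this
    simpa using this.le

/-- Combinations with coefficients of modulus at most one of vectors of norm at most one that have
successive supports. -/
theorem norm_sum_smul_le_of_blocks (H : IsCZeroBasis e ℓ) {v : ℕ → X} {s : ℕ → ℕ}
    (hs : Monotone s) (hv : ∀ j, ‖v j‖ ≤ 1)
    (hsupp : ∀ j k, ℓ k (v j) ≠ 0 → s j ≤ k ∧ k < s (j + 1))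
    (θ : ℕ → ℂ) (hθ : ∀ j, ‖θ j‖ ≤ 1) (F : Finset ℕ) : ‖∑ j ∈ F, θ j • v j‖ ≤ 1 := by
  refine H.norm_le _ _ zero_le_one fun k => ?_
  rw [map_sum]
  simp_rw [map_smul]
  -- Successive supports are disjoint, so at most one term is nonzero at the coordinate `k`.
  by_cases h : ∃ j ∈ F, ℓ k (v j) ≠ 0
  · obtain ⟨j, hj, hjk⟩ := h
    rw [Finset.sum_eq_single_of_mem j hj]
    · rw [smul_eq_mul, norm_mul]
      exact mul_le_one₀ (hθ j) (norm_nonneg _) ((H.norm_coord_le _ _).trans (hv j))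
    · intro i _ hij
      have : ℓ k (v i) = 0 := by
        by_contra hik
        obtain ⟨a, b⟩ := hsupp i k hik
        obtain ⟨a', b'⟩ := hsupp j k hjk
        rcases lt_or_gt_of_ne hij with h | h
        · have := hs (Nat.succ_le_of_lt h)
          simp only [Nat.succ_eq_add_one] at this
          omega
        · have := hs (Nat.succ_le_of_lt h)
          simp only [Nat.succ_eq_add_one] at this
          omega
      rw [this, smul_zero]
  · push Not at h
    rw [Finset.sum_eq_zero]
    · simp
    · intro i hi
      rw [h i hi, smul_zero]

end IsCZeroBasis

/-! ### Multilinear forms -/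

/-- The space of continuous `m`-linear forms on `X`. -/
abbrev MForm (X : Type*) [NormedAddCommGroup X] [NormedSpace ℂ X] (m : ℕ) : Type _ :=
  ContinuousMultilinearMap ℂ (fun _ : Fin m => X) ℂ

/-- The multilinear form `(x₁, …, xₘ) ↦ ∏ₖ ℓ_{iₖ}(xₖ)`. -/
def MForm.monomial (ℓ : ℕ → StrongDual ℂ X) {m : ℕ} (i : Fin m → ℕ) : MForm X m :=
  (ContinuousMultilinearMap.mkPiAlgebra ℂ (Fin m) ℂ).compContinuousLinearMap fun k => ℓ (i k)

theorem MForm.monomial_apply (ℓ : ℕ → StrongDual ℂ X) {m : ℕ} (i : Fin m → ℕ) (x : Fin m → X) :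
    MForm.monomial ℓ i x = ∏ k, ℓ (i k) (x k) := by
  simp [MForm.monomial]

/-- Precomposition of all the variables with the projection onto the first `n` coordinates. -/
def MForm.truncL (e : ℕ → X) (ℓ : ℕ → StrongDual ℂ X) (m n : ℕ) : MForm X m →L[ℂ] MForm X m :=
  ContinuousMultilinearMap.compContinuousLinearMapL fun _ => basisProj e ℓ n

theorem MForm.truncL_apply {m : ℕ} (n : ℕ) (a : MForm X m) (x : Fin m → X) :
    MForm.truncL e ℓ m n a x = a fun k => basisProj e ℓ n (x k) := rfl

theorem MForm.norm_truncL_apply_le (H : IsCZeroBasis e ℓ) {m : ℕ} (n : ℕ) (a : MForm X m) :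
    ‖MForm.truncL e ℓ m n a‖ ≤ ‖a‖ := by
  refine ContinuousMultilinearMap.opNorm_le_bound (norm_nonneg a) fun x => ?_
  rw [MForm.truncL_apply]
  refine (a.le_opNorm _).trans ?_
  gcongr with k
  exact H.norm_basisProj_apply_le n (x k)

/-- This is what makes induction on the degree possible: truncation cuts the first variable and
truncates the remaining form. -/
theorem MForm.curryLeft_truncL {m : ℕ} (n : ℕ) (a : MForm X (m + 1)) (x : X) :
    (MForm.truncL e ℓ (m + 1) n a).curryLeft x =
      MForm.truncL e ℓ m n (a.curryLeft (basisProj e ℓ n x)) := by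
  ext w
  rw [ContinuousMultilinearMap.curryLeft_apply, MForm.truncL_apply, MForm.truncL_apply,
    ContinuousMultilinearMap.curryLeft_apply]
  congr 1
  ext k
  refine Fin.cases ?_ (fun k => ?_) k <;> simp

theorem MForm.truncL_eq_sum {m : ℕ} (n : ℕ) (a : MForm X m) :
    MForm.truncL e ℓ m n a = ∑ i ∈ Fintype.piFinset fun _ : Fin m => Finset.range n,
      a (fun k => e (i k)) • MForm.monomial ℓ i := by
  ext x
  rw [MForm.truncL_apply, _root_.sum_apply]
  simp only [basisProj_apply, seqTrunc]
  rw [← ContinuousMultilinearMap.coe_coe, MultilinearMap.map_sum_finset]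
  refine Finset.sum_congr rfl fun i _ => ?_
  rw [MultilinearMap.map_smul_univ, _root_.smul_apply, MForm.monomial_apply, smul_eq_mul,
    smul_eq_mul, mul_comm, ContinuousMultilinearMap.coe_coe]

/-- Let `c` be a sequence of `m`-linear forms which is absolutely summable at each point, with
uniform bounds. Then for bounded multipliers `θ` the series `∑ θⱼ cⱼ` sums pointwise to an
`m`-linear form. -/
theorem MForm.exists_pointwise_sum {m : ℕ} (c : ℕ → MForm X m) {C : ℝ}
    (hc : ∀ (w : Fin m → X) (s : Finset ℕ), ∑ j ∈ s, ‖c j w‖ ≤ C * ∏ k, ‖w k‖)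
    (hC : 0 ≤ C) (θ : ℕ → ℂ) (hθ : ∀ j, ‖θ j‖ ≤ 1) :
    ∃ S : MForm X m, ‖S‖ ≤ C ∧ ∀ w, S w = ∑' j, θ j * c j w := by
  have hsn : ∀ w, Summable fun j => ‖c j w‖ := fun w =>
    summable_of_sum_le (fun _ => norm_nonneg _) (hc w)
  have hle : ∀ w j, ‖θ j * c j w‖ ≤ ‖c j w‖ := fun w j => by
    rw [norm_mul]; exact mul_le_of_le_one_left (norm_nonneg _) (hθ j)
  have hs : ∀ w, Summable fun j => θ j * c j w := fun w =>
    Summable.of_norm_bounded (hsn w) (hle w)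
  let S : MultilinearMap ℂ (fun _ : Fin m => X) ℂ :=
    { toFun := fun w => ∑' j, θ j * c j w
      map_update_add' := by
        intro _ w i x y
        rw [← (hs _).tsum_add (hs _)]
        refine tsum_congr fun j => ?_
        rw [(c j).map_update_add, mul_add]
      map_update_smul' := by
        intro _ w i r x
        rw [smul_eq_mul, ← tsum_mul_left]
        refine tsum_congr fun j => ?_
        rw [(c j).map_update_smul, smul_eq_mul]
        ring }
  have hS : ∀ w, ‖S w‖ ≤ C * ∏ k, ‖w k‖ := fun w =>
    (tsum_of_norm_bounded (hsn w).hasSum (hle w)).trans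
      ((hsn w).tsum_le_of_sum_le (hc w))
  exact ⟨S.mkContinuous C hS, S.mkContinuous_norm_le hC hS, fun w => rfl⟩

/-! ### A Riemann–Lebesgue argument -/

/-- The function `t ↦ exp (2πit)`. -/
def fourierExp (t : ℝ) : ℂ := Complex.exp (2 * Real.pi * t * Complex.I)

theorem norm_fourierExp (t : ℝ) : ‖fourierExp t‖ = 1 := by
  have := Complex.norm_exp_ofReal_mul_I (2 * Real.pi * t)
  rw [fourierExp]
  exact_mod_cast this

@[fun_prop] theorem continuous_fourierExp : Continuous fourierExp := by
  unfold fourierExp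
  fun_prop

theorem fourierChar_smul {E : Type*} [NormedAddCommGroup E] [NormedSpace ℂ E] (t : ℝ) (v : E) :
    Real.fourierChar t • v = fourierExp t • v := by
  rw [Circle.smul_def, Real.fourierChar_apply, fourierExp]
  push_cast
  rfl

theorem intervalIntegral_fourierExp_mul (n j : ℕ) :
    ∫ t in (0 : ℝ)..1, fourierExp (-(t * n)) * fourierExp (t * j) =
      if j = n then 1 else 0 := by
  have h : ∀ t : ℝ, fourierExp (-(t * n)) * fourierExp (t * j) =
      Complex.exp ((2 * Real.pi * Complex.I * ((j : ℂ) - n)) * t) := by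
    intro t
    rw [fourierExp, fourierExp, ← Complex.exp_add]
    congr 1
    push_cast
    ring
  simp_rw [h]
  split_ifs with hjn
  · simp [hjn]
  · have hne : (j : ℂ) - n ≠ 0 := sub_ne_zero.2 (by exact_mod_cast hjn)
    have hc : (2 * Real.pi * Complex.I * ((j : ℂ) - n)) ≠ 0 :=
      mul_ne_zero Complex.two_pi_I_ne_zero hne
    rw [integral_exp_mul_complex hc]
    have h1 : Complex.exp (2 * Real.pi * Complex.I * ((j : ℂ) - n) * (1 : ℝ)) = 1 := by
      rw [Complex.exp_eq_one_iff]
      exact ⟨(j : ℤ) - n, by push_cast; ring⟩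
    rw [h1]
    simp

-- The forms `c n` are the Fourier coefficients of `S`, as integrating the series at each point `w`
-- shows, so the vector-valued Riemann–Lebesgue lemma applies. The series need only converge
-- pointwise; strong measurability of `S` makes the Bochner integrals meaningful.
open MeasureTheory in
theorem tendsto_zero_of_fourierSeries {m : ℕ} (c : ℕ → MForm X m) (S : ℝ → MForm X m)
    {C : ℝ} (hX : StronglyMeasurable S) (hXC : ∀ t, ‖S t‖ ≤ C)
    (hs : ∀ w, Summable fun j => ‖c j w‖)
    (hXc : ∀ t w, S t w = ∑' j : ℕ, fourierExp (t * j) * c j w) :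
    Tendsto c atTop (𝓝 0) := by
  have hint : ∀ n : ℕ, IntegrableOn (fun t : ℝ => fourierExp (-(t * n)) • S t) (Ioc 0 1) := by
    intro n
    have hcont : Continuous fun t : ℝ => fourierExp (-(t * n)) := by fun_prop
    refine Measure.integrableOn_of_bounded (M := C) (by simp)
      (hcont.stronglyMeasurable.smul hX).aestronglyMeasurable ?_
    exact Eventually.of_forall fun t => by rw [norm_smul, norm_fourierExp, one_mul]; exact hXC t
  have key : ∀ n : ℕ, ∫ t : ℝ, fourierExp (-(t * n)) • (Ioc (0 : ℝ) 1).indicator S t = c n := by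
    intro n
    have h1 : (fun t : ℝ => fourierExp (-(t * n)) • (Ioc (0 : ℝ) 1).indicator S t) =
        (Ioc (0 : ℝ) 1).indicator fun t => fourierExp (-(t * n)) • S t := by
      ext1 t
      by_cases ht : t ∈ Ioc (0 : ℝ) 1
      · simp [ht]
      · rw [indicator_of_notMem ht, indicator_of_notMem ht]
        exact smul_zero (A := MForm X m) (fourierExp (-(t * n)))
    rw [h1, integral_indicator measurableSet_Ioc]
    ext w
    have h2 := ((ContinuousMultilinearMap.apply ℂ (fun _ : Fin m => X) ℂ
      w).integral_comp_comm (hint n)).symm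
    simp only [ContinuousMultilinearMap.apply_apply] at h2
    rw [h2, ← intervalIntegral.integral_of_le zero_le_one]
    have h3 : HasSum (fun j : ℕ => ∫ t in (0 : ℝ)..1, fourierExp (-(t * n)) *
        fourierExp (t * j) * c j w)
        (∫ t in (0 : ℝ)..1, (fourierExp (-(t * n)) • S t) w) := by
      refine intervalIntegral.hasSum_integral_of_dominated_convergence
        (fun j _ => ‖c j w‖) ?_ ?_ ?_ ?_ ?_
      · intro j
        exact Continuous.aestronglyMeasurable (by fun_prop)
      · intro j
        refine Eventually.of_forall fun t _ => ?_
        simp [norm_fourierExp]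
      · exact Eventually.of_forall fun t _ => hs w
      · exact intervalIntegrable_const
      · refine Eventually.of_forall fun t _ => ?_
        have : Summable fun j : ℕ => fourierExp (t * j) * c j w :=
          Summable.of_norm_bounded (hs w) fun j => by simp [norm_fourierExp]
        have h4 := this.hasSum.mul_left (fourierExp (-(t * n)))
        rw [← hXc] at h4
        simp_rw [← mul_assoc] at h4
        exact h4
    have h5 : ∀ j : ℕ, (∫ t in (0 : ℝ)..1, fourierExp (-(t * n)) *
        fourierExp (t * j) * c j w) = if j = n then c j w else 0 := by
      intro j
      rw [intervalIntegral.integral_mul_const, intervalIntegral_fourierExp_mul]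
      split_ifs <;> simp
    simp_rw [h5] at h3
    refine h3.unique ?_
    convert! hasSum_ite_eq n (c n w) using 2 with j
    split_ifs with h <;> simp [h]
  have hRL := (Real.tendsto_integral_exp_smul_cocompact ((Ioc (0 : ℝ) 1).indicator S)).comp
    (tendsto_natCast_atTop_atTop.mono_right atTop_le_cocompact)
  refine hRL.congr fun n => ?_
  rw [← key n]
  simp only [Function.comp_apply, fourierChar_smul]

/-! ### Approximation of multilinear forms -/

/-- Rotating each `φ (v j)` onto the positive axis turns the sum of moduli into the value of `φ` at
one admissible combination. -/
theorem sum_norm_le_of_forall_sum_smul {E : Type*} [NormedAddCommGroup E] [NormedSpace ℂ E]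
    (v : ℕ → E) (F : Finset ℕ)
    (hv : ∀ θ : ℕ → ℂ, (∀ j, ‖θ j‖ ≤ 1) → ‖∑ j ∈ F, θ j • v j‖ ≤ 1) (φ : StrongDual ℂ E) :
    ∑ j ∈ F, ‖φ (v j)‖ ≤ ‖φ‖ := by
  let θ : ℕ → ℂ := fun n => star (φ (v n)) / (‖φ (v n)‖ : ℂ)
  have hθ : ∀ n, ‖θ n‖ ≤ 1 := by
    intro n
    simp only [θ, norm_div, norm_star, Complex.norm_real, norm_norm]
    exact div_self_le_one _
  have hθφ : ∀ n, θ n * φ (v n) = (‖φ (v n)‖ : ℂ) := by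
    intro n
    by_cases h : φ (v n) = 0
    · simp [θ, h]
    · have h' : (‖φ (v n)‖ : ℂ) ≠ 0 := by simpa using h
      have := Complex.conj_mul' (φ (v n))
      simp only [θ, Complex.star_def, div_mul_eq_mul_div]
      rw [this, sq, mul_div_assoc, div_self h', mul_one]
  have h1 : φ (∑ n ∈ F, θ n • v n) = ((∑ n ∈ F, ‖φ (v n)‖ : ℝ) : ℂ) := by
    rw [map_sum]
    push_cast
    exact Finset.sum_congr rfl fun n _ => by rw [map_smul, smul_eq_mul, hθφ]
  have h2 : ‖((∑ n ∈ F, ‖φ (v n)‖ : ℝ) : ℂ)‖ = ∑ n ∈ F, ‖φ (v n)‖ := by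
    rw [Complex.norm_real, Real.norm_of_nonneg (Finset.sum_nonneg fun _ _ => norm_nonneg _)]
  rw [← h2, ← h1]
  exact (φ.le_opNorm _).trans (mul_le_of_le_one_right (norm_nonneg _) (hv θ hθ))

/-- If all `m`-linear forms are approximated by their truncations, then a bounded operator from `X`
to the `m`-linear forms maps block sequences to null sequences. -/
theorem tendsto_apply_blocks {m : ℕ}
    (hm : ∀ a : MForm X m, Tendsto (fun n => MForm.truncL e ℓ m n a) atTop (𝓝 a))
    (T : X →L[ℂ] MForm X m) {v : ℕ → X}
    (hv : ∀ (F : Finset ℕ) (θ : ℕ → ℂ), (∀ j, ‖θ j‖ ≤ 1) → ‖∑ j ∈ F, θ j • v j‖ ≤ 1) :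
    Tendsto (fun j => T (v j)) atTop (𝓝 0) := by
  have hc : ∀ (w : Fin m → X) (s : Finset ℕ),
      ∑ j ∈ s, ‖T (v j) w‖ ≤ ‖T‖ * ∏ k, ‖w k‖ := by
    intro w s
    refine (sum_norm_le_of_forall_sum_smul v s (hv s)
      ((ContinuousMultilinearMap.apply ℂ (fun _ : Fin m => X) ℂ w).comp T)).trans ?_
    refine ContinuousLinearMap.opNorm_le_bound _ (by positivity) fun x => ?_
    change ‖T x w‖ ≤ _
    refine ((T x).le_opNorm w).trans ?_
    calc ‖T x‖ * ∏ k, ‖w k‖ ≤ (‖T‖ * ‖x‖) * ∏ k, ‖w k‖ := by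
          gcongr; exact T.le_opNorm x
      _ = ‖T‖ * (∏ k, ‖w k‖) * ‖x‖ := by ring
  have hsn : ∀ w, Summable fun j => ‖T (v j) w‖ := fun w =>
    summable_of_sum_le (fun _ => norm_nonneg _) (hc w)
  choose S hXC hX using fun t : ℝ => MForm.exists_pointwise_sum (fun j => T (v j)) hc (norm_nonneg T)
    (fun j => fourierExp (t * j)) (fun j => (norm_fourierExp _).le)
  refine tendsto_zero_of_fourierSeries _ S ?_ hXC hsn hX
  -- The series for `S` is controlled only pointwise on `X`, so norm continuity in `t` is not at
  -- hand. The truncations of `S t` are finite combinations of fixed monomials with coefficients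
  -- continuous in `t`, and by `hm` they converge to `S t` in norm.
  refine stronglyMeasurable_of_tendsto atTop (f := fun n t => MForm.truncL e ℓ m n (S t)) ?_ ?_
  · intro n
    refine Continuous.stronglyMeasurable ?_
    simp_rw [MForm.truncL_eq_sum]
    refine continuous_finsetSum _ fun i _ => Continuous.fun_smul ?_ continuous_const
    simp_rw [hX]
    refine continuous_tsum (u := fun j => ‖T (v j) fun k => e (i k)‖) ?_ (hsn _) ?_
    · intro j; fun_prop
    · intro j t; simp [norm_fourierExp]
  · rw [tendsto_pi_nhds]
    exact fun t => hm (S t)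

/-- If all `m`-linear forms are approximated by their truncations, then so is a bounded operator
from `X` to the `m`-linear forms. -/
theorem tendsto_comp_basisProj (H : IsCZeroBasis e ℓ) {m : ℕ}
    (hm : ∀ a : MForm X m, Tendsto (fun n => MForm.truncL e ℓ m n a) atTop (𝓝 a))
    (T : X →L[ℂ] MForm X m) {ε : ℝ} (hε : 0 < ε) :
    ∃ N, ∀ n ≥ N, ∀ x, ‖T (x - basisProj e ℓ n x)‖ ≤ ε * ‖x‖ := by
  by_contra! hcon
  -- Gliding hump: a bad tail beyond `n` is cut far out, which costs at most half of `ε` and leaves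
  -- a finitely supported block.
  have hblock : ∀ n, ∃ N > n, ∃ v : X, ‖v‖ ≤ 1 ∧ (∀ k, ℓ k v ≠ 0 → n ≤ k ∧ k < N) ∧
      ε / 2 ≤ ‖T v‖ := by
    intro n
    obtain ⟨n', hn', x, hx⟩ := hcon n
    have hx0 : 0 < ‖x‖ := by
      rw [norm_pos_iff]
      rintro rfl
      simp at hx
    set y : X := ((‖x‖ : ℂ)⁻¹) • x with hy
    have hy1 : ‖y‖ ≤ 1 := by
      rw [hy, norm_smul, norm_inv, Complex.norm_real, norm_norm, inv_mul_cancel₀ hx0.ne']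
    have hTy : ε < ‖T (y - basisProj e ℓ n' y)‖ := by
      rw [hy, map_smul, ← smul_sub, map_smul, norm_smul, norm_inv, Complex.norm_real, norm_norm,
        inv_mul_eq_div, lt_div_iff₀ hx0]
      exact hx
    set u := y - basisProj e ℓ n' y with hu
    have hlim : Tendsto (fun N => ‖T (basisProj e ℓ N u)‖) atTop (𝓝 ‖T u‖) :=
      ((T.continuous.tendsto u).comp (H.tendsto_basisProj u)).norm
    obtain ⟨N, hN1, hN2⟩ := ((hlim.eventually (lt_mem_nhds (b := ‖T u‖) (a := ε / 2)
      (by linarith))).and (eventually_gt_atTop n)).exists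
    refine ⟨N, hN2, basisProj e ℓ N u, ?_, ?_, hN1.le⟩
    · exact (H.norm_basisProj_apply_le _ _).trans ((H.norm_sub_basisProj_apply_le _ _).trans hy1)
    · intro k hk
      rw [H.coord_basisProj, hu, map_sub, H.coord_basisProj] at hk
      split_ifs at hk with h1 h2
      · simp at hk
      · exact ⟨by omega, h1⟩
      · simp at hk
  choose N hN v hv hsupp hT using hblock
  -- Each block starts where the preceding one ends.
  let s : ℕ → ℕ := fun j => Nat.rec 0 (fun _ n => N n) j
  have hs : Monotone s := monotone_nat_of_le_succ fun j => (hN (s j)).le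
  have h0 := tendsto_apply_blocks hm T (v := fun j => v (s j)) fun F θ hθ =>
    H.norm_sum_smul_le_of_blocks hs (fun j => hv (s j)) (fun j k hk => hsupp (s j) k hk) θ hθ F
  obtain ⟨j, hj⟩ := ((Metric.tendsto_atTop.1 h0) (ε / 2) (half_pos hε))
  have := hj j le_rfl
  rw [dist_zero_right] at this
  exact absurd this (not_lt.2 (hT (s j)))

/-- Every continuous multilinear form is the limit of its truncations. -/
theorem tendsto_truncL (H : IsCZeroBasis e ℓ) (m : ℕ) (a : MForm X m) :
    Tendsto (fun n => MForm.truncL e ℓ m n a) atTop (𝓝 a) := by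
  induction m with
  | zero =>
    refine tendsto_const_nhds.congr fun n => ?_
    ext x
    rw [MForm.truncL_apply]
    congr 1
    ext k
    exact k.elim0
  | succ m ih =>
    let T : X →L[ℂ] MForm X m := a.curryLeft
    rw [Metric.tendsto_atTop]
    intro ε hε
    -- Four errors of size `ε / 8` will occur; their total `ε / 2` leaves room for a strict
    -- inequality.
    obtain ⟨N, hN⟩ := tendsto_comp_basisProj H ih T (ε := ε / 8) (by positivity)
    have hfin : Tendsto (fun n => ∑ i ∈ Finset.range N,
        ‖MForm.truncL e ℓ m n (T (e i)) - T (e i)‖) atTop (𝓝 0) := by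
      rw [← Finset.sum_const_zero (s := Finset.range N)]
      exact tendsto_finsetSum _ fun i _ => tendsto_iff_norm_sub_tendsto_zero.1 (ih (T (e i)))
    obtain ⟨N', hN'⟩ := (Metric.tendsto_atTop.1 hfin) (ε / 8) (by positivity)
    refine ⟨max N N', fun n hn => ?_⟩
    have hn1 : N ≤ n := (le_max_left _ _).trans hn
    have hn2 : N' ≤ n := (le_max_right _ _).trans hn
    have hsum : ∑ i ∈ Finset.range N, ‖MForm.truncL e ℓ m n (T (e i)) - T (e i)‖ < ε / 8 := by
      have := hN' n hn2
      rw [dist_zero_right] at this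
      exact lt_of_le_of_lt (le_abs_self _) this
    have hhead : ∀ x, ‖MForm.truncL e ℓ m n (T (basisProj e ℓ N x)) - T (basisProj e ℓ N x)‖ ≤
        ε / 8 * ‖x‖ := by
      intro x
      have : MForm.truncL e ℓ m n (T (basisProj e ℓ N x)) - T (basisProj e ℓ N x) =
          ∑ i ∈ Finset.range N, ℓ i x • (MForm.truncL e ℓ m n (T (e i)) - T (e i)) := by
        rw [basisProj_apply, seqTrunc]
        simp only [map_sum, map_smul, smul_sub, Finset.sum_sub_distrib]
      rw [this]
      refine (norm_sum_le _ _).trans ?_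
      calc ∑ i ∈ Finset.range N, ‖ℓ i x • (MForm.truncL e ℓ m n (T (e i)) - T (e i))‖
          ≤ ∑ i ∈ Finset.range N, ‖x‖ * ‖MForm.truncL e ℓ m n (T (e i)) - T (e i)‖ := by
            refine Finset.sum_le_sum fun i _ => ?_
            rw [norm_smul]
            gcongr
            exact H.norm_coord_le i x
        _ = ‖x‖ * ∑ i ∈ Finset.range N, ‖MForm.truncL e ℓ m n (T (e i)) - T (e i)‖ :=
            (Finset.mul_sum _ _ _).symm
        _ ≤ ‖x‖ * (ε / 8) := by gcongr
        _ = ε / 8 * ‖x‖ := mul_comm _ _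
    have hT : ∀ x, ‖(MForm.truncL e ℓ (m + 1) n a - a).curryLeft x‖ ≤ ε / 2 * ‖x‖ := by
      intro x
      -- Only the finitely many forms `T (e i)` with `i < N` need the inductive hypothesis; the
      -- other three terms are controlled by values of `T` at tails.
      have e1 : (MForm.truncL e ℓ (m + 1) n a - a).curryLeft x =
          (MForm.truncL e ℓ m n (T (basisProj e ℓ N x)) - T (basisProj e ℓ N x)) +
          MForm.truncL e ℓ m n (T (x - basisProj e ℓ N x)) -
          MForm.truncL e ℓ m n (T (x - basisProj e ℓ n x)) -
          T (x - basisProj e ℓ N x) := by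
        have : (MForm.truncL e ℓ (m + 1) n a - a).curryLeft x =
            (MForm.truncL e ℓ (m + 1) n a).curryLeft x - T x := rfl
        rw [this, MForm.curryLeft_truncL]
        change MForm.truncL e ℓ m n (T (basisProj e ℓ n x)) - T x = _
        simp only [map_sub]
        abel
      rw [e1]
      have h1 := hhead x
      have h2 := (MForm.norm_truncL_apply_le H n (T (x - basisProj e ℓ N x))).trans
        (hN N le_rfl x)
      have h3 := (MForm.norm_truncL_apply_le H n (T (x - basisProj e ℓ n x))).trans
        (hN n hn1 x)
      have h4 := hN N le_rfl x
      refine (norm_sub_le _ _).trans ?_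
      have h5 := norm_sub_le (MForm.truncL e ℓ m n (T (basisProj e ℓ N x)) -
        T (basisProj e ℓ N x) + MForm.truncL e ℓ m n (T (x - basisProj e ℓ N x)))
        (MForm.truncL e ℓ m n (T (x - basisProj e ℓ n x)))
      have h6 := norm_add_le (MForm.truncL e ℓ m n (T (basisProj e ℓ N x)) -
        T (basisProj e ℓ N x)) (MForm.truncL e ℓ m n (T (x - basisProj e ℓ N x)))
      linarith
    rw [dist_eq_norm, ← ContinuousMultilinearMap.curryLeft_norm]
    exact lt_of_le_of_lt (ContinuousLinearMap.opNorm_le_bound _ (by positivity) hT) (half_lt_self hε)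

end CZeroBasis

/-! ### Taylor polynomials -/

section Taylor

variable {X : Type*} [NormedAddCommGroup X] [NormedSpace ℂ X]

/-- The multilinear form of the `m`-th Taylor polynomial of `F` at the origin. -/
def taylorForm (F : X → ℂ) (m : ℕ) : MForm X m :=
  (Nat.factorial m : ℂ)⁻¹ • iteratedFDeriv ℂ m F 0

/-- Restriction to the complex line through `x` brings Taylor coefficients down to one variable,
where Cauchy's estimate and Taylor's theorem on a disc are available. -/
theorem iteratedDeriv_comp_smul {F : X → ℂ} (hF : AnalyticOnNhd ℂ F (ball 0 1)) (x : X) (m : ℕ) :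
    iteratedDeriv m (fun t : ℂ => F (t • x)) 0 = iteratedFDeriv ℂ m F 0 fun _ => x := by
  let g : ℂ →L[ℂ] X := ContinuousLinearMap.toSpanSingleton ℂ x
  have hg : IsOpen (g ⁻¹' ball 0 1) := isOpen_ball.preimage g.continuous
  have h0 : g 0 ∈ ball (0 : X) 1 := by simp
  have h := g.iteratedFDerivWithin_comp_right (n := ⊤) (s := ball (0 : X) 1) (f := F)
    (hF.contDiffOn isOpen_ball.uniqueDiffOn) isOpen_ball.uniqueDiffOn hg.uniqueDiffOn h0 (i := m)
    (by exact_mod_cast le_top)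
  rw [iteratedFDerivWithin_of_isOpen m hg (by simp),
    iteratedFDerivWithin_of_isOpen m isOpen_ball h0, map_zero] at h
  rw [iteratedDeriv_eq_iteratedFDeriv]
  change iteratedFDeriv ℂ m (F ∘ g) 0 (fun _ => 1) = _
  rw [h]
  simp [g]

theorem differentiableOn_comp_smul {F : X → ℂ} (hF : AnalyticOnNhd ℂ F (ball 0 1)) {x : X} {s : ℝ}
    (hs : s * ‖x‖ ≤ 1) : DifferentiableOn ℂ (fun t : ℂ => F (t • x)) (ball 0 s) := by
  refine hF.differentiableOn.comp (t := ball 0 1) (by fun_prop) fun t ht => ?_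
  rw [mem_ball_zero_iff] at ht ⊢
  rw [norm_smul]
  rcases (norm_nonneg x).eq_or_lt with h | h
  · rw [← h]; simp
  · exact (mul_lt_mul_of_pos_right ht h).trans_le hs

theorem norm_taylorForm_le {F : X → ℂ} (hF : AnalyticOnNhd ℂ F (ball 0 1)) {C : ℝ}
    (hC : ∀ y ∈ ball (0 : X) 1, ‖F y‖ ≤ C) {x : X} {s : ℝ} (hs : 0 < s) (hsx : s * ‖x‖ < 1)
    (m : ℕ) : ‖taylorForm F m fun _ => x‖ ≤ C / s ^ m := by
  -- Cauchy's estimate on the circle of radius `s` needs holomorphy on a larger disc.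
  obtain ⟨s', hs', hs'x⟩ : ∃ s' > s, s' * ‖x‖ ≤ 1 := by
    rcases (norm_nonneg x).eq_or_lt with h | h
    · exact ⟨s + 1, by linarith, by rw [← h]; simp⟩
    · exact ⟨1 / ‖x‖, by rwa [gt_iff_lt, lt_div_iff₀ h], by field_simp; rfl⟩
  have hd := differentiableOn_comp_smul hF hs'x
  have h1 := Complex.norm_iteratedDeriv_le_of_forall_mem_sphere_norm_le (c := 0) (C := C) m hs
    (f := fun t : ℂ => F (t • x))
    (hd.diffContOnCl_ball (closedBall_subset_ball hs')) (by
      intro t ht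
      refine hC _ ?_
      rw [mem_sphere_zero_iff_norm] at ht
      rw [mem_ball_zero_iff, norm_smul, ht]
      exact hsx)
  rw [iteratedDeriv_comp_smul hF] at h1
  rw [taylorForm, _root_.smul_apply, norm_smul, norm_inv, Complex.norm_natCast]
  have hm : (0 : ℝ) < m.factorial := by positivity
  rw [inv_mul_le_iff₀ hm]
  rwa [mul_div_assoc] at h1

theorem hasSum_taylorForm {F : X → ℂ} (hF : AnalyticOnNhd ℂ F (ball 0 1)) {x : X} (hx : ‖x‖ < 1) :
    HasSum (fun m => taylorForm F m fun _ => x) (F x) := by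
  -- The Taylor series is evaluated at `t = 1`, which has to be interior to the disc of holomorphy.
  obtain ⟨s, hs, hsx⟩ : ∃ s > 1, s * ‖x‖ ≤ 1 := by
    rcases (norm_nonneg x).eq_or_lt with h | h
    · exact ⟨2, by norm_num, by rw [← h]; simp⟩
    · exact ⟨1 / ‖x‖, by rwa [gt_iff_lt, lt_div_iff₀ h, one_mul], by field_simp; rfl⟩
  have h := Complex.hasSum_taylorSeries_on_ball (differentiableOn_comp_smul hF hsx)
    (z := 1) (by simpa using hs)
  simp only [sub_zero, one_pow, one_smul, iteratedDeriv_comp_smul hF] at h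
  exact h

end Taylor

/-! ### Elements of `𝒜_u` -/

section AuElements

variable {X : Type*} [NormedAddCommGroup X] [NormedSpace ℂ X]

/-- The element of `𝒜_u(B_X)` given by a function on `X`. -/
def Au.ofFun (F : X → ℂ) (hF : AnalyticOnNhd ℂ F (ball 0 1))
    (hu : UniformContinuousOn F (ball 0 1)) (C : ℝ) (hC : ∀ x ∈ ball (0 : X) 1, ‖F x‖ ≤ C) :
    Au X :=
  ⟨BoundedContinuousFunction.ofNormedAddCommGroup (fun x : ball (0 : X) 1 => F x)
    (uniformContinuousOn_iff_restrict.1 hu).continuous C fun x => hC x x.2,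
    uniformContinuousOn_iff_restrict.1 hu, hF.congr isOpen_ball fun x hx => by
      rw [zeroExt_eq _ hx]; rfl⟩

theorem Au.norm_apply_le (f : Au X) (x : ball (0 : X) 1) : ‖f.1 x‖ ≤ ‖f‖ :=
  f.1.norm_coe_le_norm x

theorem Au.norm_le_of_forall {f : Au X} {C : ℝ} (h : ∀ x, ‖f.1 x‖ ≤ C) : ‖f‖ ≤ C :=
  (BoundedContinuousFunction.norm_le ((norm_nonneg _).trans (h ⟨0, by simp⟩))).2 h

theorem Au.ext {f g : Au X} (h : ∀ x, f.1 x = g.1 x) : f = g :=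
  Subtype.ext (BoundedContinuousFunction.ext h)

theorem Au.norm_zeroExt_le (f : Au X) (x : X) (hx : x ∈ ball (0 : X) 1) :
    ‖zeroExt f.1 x‖ ≤ ‖f‖ := by
  rw [zeroExt_eq _ hx]
  exact (Au.norm_apply_le f) _

theorem Au.analytic (f : Au X) : AnalyticOnNhd ℂ (zeroExt f.1) (ball 0 1) := f.2.2

theorem Au.uniformContinuousOn (f : Au X) : UniformContinuousOn (zeroExt f.1) (ball 0 1) := by
  rw [uniformContinuousOn_iff_restrict]
  convert! f.2.1 using 1
  ext x
  exact zeroExt_eq _ x.2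

/-- A continuous linear functional as an element of `𝒜_u(B_X)`. -/
def Au.ofDual (φ : StrongDual ℂ X) : Au X :=
  Au.ofFun φ (φ.analyticOnNhd _) φ.uniformContinuous.uniformContinuousOn ‖φ‖ fun x hx =>
    (φ.le_opNorm x).trans (mul_le_of_le_one_right (norm_nonneg _) (mem_ball_zero_iff.1 hx).le)

@[simp] theorem Au.ofDual_apply (φ : StrongDual ℂ X) (x : ball (0 : X) 1) :
    (Au.ofDual φ).1 x = φ x := rfl

/-- Composition with a contraction. -/
def Au.compCLM {Y : Type*} [NormedAddCommGroup Y] [NormedSpace ℂ Y] (R : X →L[ℂ] Y)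
    (hR : ∀ x, ‖R x‖ ≤ ‖x‖) (g : Au Y) : Au X :=
  have hmaps : MapsTo R (ball 0 1) (ball 0 1) := fun x hx => by
    rw [mem_ball_zero_iff] at hx ⊢
    exact (hR x).trans_lt hx
  Au.ofFun (fun x => zeroExt g.1 (R x))
    ((Au.analytic g).comp (R.analyticOnNhd _) hmaps)
    ((Au.uniformContinuousOn g).comp R.uniformContinuous.uniformContinuousOn hmaps) ‖g‖
    fun x hx => (Au.norm_zeroExt_le g) _ (hmaps hx)

theorem Au.compCLM_apply {Y : Type*} [NormedAddCommGroup Y] [NormedSpace ℂ Y] (R : X →L[ℂ] Y)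
    (hR : ∀ x, ‖R x‖ ≤ ‖x‖) (g : Au Y) (x : ball (0 : X) 1) (hx : R x ∈ ball (0 : Y) 1) :
    (Au.compCLM R hR g).1 x = g.1 ⟨R x, hx⟩ :=
  zeroExt_eq _ hx

theorem Au.norm_compCLM_le {Y : Type*} [NormedAddCommGroup Y] [NormedSpace ℂ Y] (R : X →L[ℂ] Y)
    (hR : ∀ x, ‖R x‖ ≤ ‖x‖) (g : Au Y) : ‖Au.compCLM R hR g‖ ≤ ‖g‖ :=
  Au.norm_le_of_forall fun x => (Au.norm_zeroExt_le g) _ (by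
    have := x.2
    rw [mem_ball_zero_iff] at this ⊢
    exact (hR x).trans_lt this)

end AuElements

/-! ### Density of the polynomials in the coordinates -/

section Density

variable {X : Type*} [NormedAddCommGroup X] [NormedSpace ℂ X]

/-- The polynomials in the coordinates. -/
def coordPoly (ℓ : ℕ → StrongDual ℂ X) : Subalgebra ℂ (Au X) :=
  Algebra.adjoin ℂ (range fun n => Au.ofDual (ℓ n))

/-- Evaluation at a point as an algebra homomorphism. -/
def Au.evalHom (x : ball (0 : X) 1) : Au X →ₐ[ℂ] ℂ where
  toFun f := f.1 x
  map_one' := rfl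
  map_mul' _ _ := rfl
  map_zero' := rfl
  map_add' _ _ := rfl
  commutes' _ := rfl

@[simp] theorem Au.evalHom_apply (x : ball (0 : X) 1) (f : Au X) : Au.evalHom x f = f.1 x := rfl

theorem Au.evalHom_smul (x : ball (0 : X) 1) (c : ℂ) (f : Au X) :
    Au.evalHom x (c • f) = c • f.1 x := rfl

variable {e : ℕ → X} {ℓ : ℕ → StrongDual ℂ X}

/-- A truncated form is a finite combination of monomials, hence a polynomial in the coordinates on
the diagonal. -/
theorem exists_coordPoly_eq_truncL {m : ℕ} (a : MForm X m) (n : ℕ) :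
    ∃ q ∈ coordPoly ℓ, ∀ x : ball (0 : X) 1, q.1 x = MForm.truncL e ℓ m n a fun _ => x := by
  refine ⟨∑ i ∈ Fintype.piFinset fun _ : Fin m => Finset.range n,
    a (fun k => e (i k)) • ∏ k, Au.ofDual (ℓ (i k)), ?_, fun x => ?_⟩
  · refine Subalgebra.sum_mem _ fun i _ => Subalgebra.smul_mem _ (Subalgebra.prod_mem _ fun k _ => ?_) _
    exact Algebra.subset_adjoin ⟨i k, rfl⟩
  · rw [← Au.evalHom_apply, MForm.truncL_eq_sum]
    simp only [map_sum, Au.evalHom_smul, ← Au.evalHom_apply]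
    simp only [map_prod, Au.evalHom_apply, Au.ofDual_apply, _root_.sum_apply,
      _root_.smul_apply, MForm.monomial_apply]

/-- The polynomials in the coordinates are dense in `𝒜_u(B_X)`. -/
theorem exists_coordPoly_norm_sub_le (H : IsCZeroBasis e ℓ) (f : Au X) {ε : ℝ} (hε : 0 < ε) :
    ∃ q ∈ coordPoly ℓ, ‖f - q‖ ≤ ε := by
  set F := zeroExt f.1 with hFdef
  obtain ⟨d, hd, hfd⟩ := (Metric.uniformContinuousOn_iff.1 (Au.uniformContinuousOn f)) (ε / 3)
    (by positivity)
  -- By uniform continuity `f` is close to its dilate `x ↦ f (r x)`, whose Taylor series converges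
  -- geometrically and uniformly on the ball. The maximum with `1 / 2` keeps `r` positive.
  obtain ⟨r, hr0, hr1, hrd⟩ : ∃ r : ℝ, 0 < r ∧ r < 1 ∧ 1 - r < d := by
    refine ⟨max (1 / 2) (1 - d / 2), by positivity, ?_, ?_⟩
    · exact max_lt (by norm_num) (by linarith)
    · have := le_max_right (1 / 2) (1 - d / 2)
      linarith
  have hrx : ∀ x ∈ ball (0 : X) 1, (r : ℂ) • x ∈ ball (0 : X) 1 := by
    intro x hx
    rw [mem_ball_zero_iff] at hx ⊢
    rw [norm_smul, Complex.norm_real, Real.norm_of_nonneg hr0.le]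
    nlinarith [norm_nonneg x]
  have step1 : ∀ x ∈ ball (0 : X) 1, ‖F x - F ((r : ℂ) • x)‖ ≤ ε / 3 := by
    intro x hx
    rw [← dist_eq_norm]
    refine (hfd x hx _ (hrx x hx) ?_).le
    have : x - (r : ℂ) • x = ((1 - r : ℝ) : ℂ) • x := by
      push_cast; rw [sub_smul, one_smul]
    rw [dist_eq_norm, this, norm_smul, Complex.norm_real, Real.norm_of_nonneg (by linarith)]
    rw [mem_ball_zero_iff] at hx
    nlinarith [norm_nonneg x]
  obtain ⟨M, hM⟩ : ∃ M : ℕ, ‖f‖ * r ^ M / (1 - r) ≤ ε / 3 := by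
    have : Tendsto (fun M : ℕ => ‖f‖ * r ^ M / (1 - r)) atTop (𝓝 (‖f‖ * 0 / (1 - r))) :=
      ((tendsto_pow_atTop_nhds_zero_of_lt_one hr0.le hr1).const_mul _).div_const _
    rw [mul_zero, zero_div] at this
    exact (this.eventually (ge_mem_nhds (by positivity))).exists
  have step2 : ∀ x ∈ ball (0 : X) 1,
      ‖F ((r : ℂ) • x) - ∑ m ∈ Finset.range M, taylorForm F m fun _ => (r : ℂ) • x‖ ≤ ε / 3 := by
    intro x hx
    rw [norm_sub_rev]
    refine le_trans (norm_sub_le_of_geometric_bound_of_hasSum hr1 (fun m => ?_)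
      (hasSum_taylorForm (Au.analytic f) (mem_ball_zero_iff.1 (hrx x hx))) M) hM
    have := norm_taylorForm_le (Au.analytic f) (Au.norm_zeroExt_le f) (x := (r : ℂ) • x) (s := r⁻¹)
      (by positivity) (by
        rw [norm_smul, Complex.norm_real, Real.norm_of_nonneg hr0.le, inv_mul_cancel_left₀ hr0.ne']
        exact mem_ball_zero_iff.1 hx) m
    rw [inv_pow, div_inv_eq_mul] at this
    exact this
  -- Only finitely many degrees remain, so one truncation order serves them all.
  obtain ⟨N, hN⟩ : ∃ N, ∑ m ∈ Finset.range M,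
      ‖MForm.truncL e ℓ m N (taylorForm F m) - taylorForm F m‖ ≤ ε / 3 := by
    have : Tendsto (fun N => ∑ m ∈ Finset.range M,
        ‖MForm.truncL e ℓ m N (taylorForm F m) - taylorForm F m‖) atTop (𝓝 0) := by
      rw [← Finset.sum_const_zero (s := Finset.range M)]
      exact tendsto_finsetSum _ fun m _ =>
        tendsto_iff_norm_sub_tendsto_zero.1 (tendsto_truncL H m (taylorForm F m))
    exact (this.eventually (ge_mem_nhds (by positivity))).exists
  choose q hq hqx using fun m => exists_coordPoly_eq_truncL (e := e) (ℓ := ℓ) (taylorForm F m) N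
  refine ⟨∑ m ∈ Finset.range M, (r : ℂ) ^ m • q m,
    Subalgebra.sum_mem _ fun m _ => Subalgebra.smul_mem _ (hq m) _, ?_⟩
  refine Au.norm_le_of_forall fun x => ?_
  have hx := x.2
  have e1 : (f - ∑ m ∈ Finset.range M, (r : ℂ) ^ m • q m).1 x =
      F x - ∑ m ∈ Finset.range M,
        MForm.truncL e ℓ m N (taylorForm F m) fun _ => (r : ℂ) • (x : X) := by
    rw [← Au.evalHom_apply]
    simp only [map_sub, map_sum, Au.evalHom_apply]
    rw [hFdef, zeroExt_eq _ hx]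
    congr 1
    refine Finset.sum_congr rfl fun m _ => ?_
    have := (MForm.truncL e ℓ m N (taylorForm F m)).map_smul_univ (fun _ => (r : ℂ)) fun _ => (x : X)
    change (r : ℂ) ^ m * (q m).1 x = _
    rw [hqx]
    simpa using this.symm
  rw [e1]
  have step3 : ‖(∑ m ∈ Finset.range M, taylorForm F m fun _ => (r : ℂ) • (x : X)) -
      ∑ m ∈ Finset.range M,
        MForm.truncL e ℓ m N (taylorForm F m) fun _ => (r : ℂ) • (x : X)‖ ≤ ε / 3 := by
    rw [← Finset.sum_sub_distrib]
    refine (norm_sum_le _ _).trans (le_trans (Finset.sum_le_sum fun m _ => ?_) hN)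
    rw [norm_sub_rev, ← _root_.sub_apply]
    refine (ContinuousMultilinearMap.le_opNorm _ _).trans ?_
    refine mul_le_of_le_one_right (norm_nonneg _) ?_
    exact Finset.prod_le_one (fun _ _ => norm_nonneg _)
      fun _ _ => (mem_ball_zero_iff.1 (hrx x hx)).le
  have h1 := step1 x hx
  have h2 := step2 x hx
  calc _ = ‖(F x - F ((r : ℂ) • (x : X))) + (F ((r : ℂ) • (x : X)) -
        ∑ m ∈ Finset.range M, taylorForm F m fun _ => (r : ℂ) • (x : X)) +
        ((∑ m ∈ Finset.range M, taylorForm F m fun _ => (r : ℂ) • (x : X)) -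
      ∑ m ∈ Finset.range M,
        MForm.truncL e ℓ m N (taylorForm F m) fun _ => (r : ℂ) • (x : X))‖ := by
        congr 1; ring
    _ ≤ ε / 3 + ε / 3 + ε / 3 := (norm_add_le _ _).trans
        (add_le_add ((norm_add_le _ _).trans (add_le_add h1 h2)) step3)
    _ = ε := by ring

/-- Two characters that agree on the coordinates are equal. -/
theorem character_ext (H : IsCZeroBasis e ℓ) {φ ψ : characterSpace ℂ (Au X)}
    (h : ∀ n, φ (Au.ofDual (ℓ n)) = ψ (Au.ofDual (ℓ n))) : φ = ψ := by
  have hpoly : ∀ q ∈ coordPoly ℓ, φ q = ψ q := by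
    intro q hq
    have : coordPoly ℓ ≤ AlgHom.equalizer (CharacterSpace.toAlgHom φ) (CharacterSpace.toAlgHom ψ) :=
      Algebra.adjoin_le (by rintro _ ⟨n, rfl⟩; exact h n)
    exact this hq
  refine DFunLike.ext _ _ fun f => ?_
  have hcl : f ∈ closure (coordPoly ℓ : Set (Au X)) := by
    rw [Metric.mem_closure_iff]
    intro ε hε
    obtain ⟨q, hq, hfq⟩ := exists_coordPoly_norm_sub_le H f (half_pos hε)
    exact ⟨q, hq, by rw [dist_eq_norm]; linarith⟩
  have : IsClosed {f : Au X | φ f = ψ f} :=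
    isClosed_eq (map_continuous φ) (map_continuous ψ)
  exact closure_minimal (s := (coordPoly ℓ : Set (Au X))) hpoly this hcl

end Density

/-! ### The Aron–Berner extension in coordinates -/

section AronBerner

variable {X : Type*} [NormedAddCommGroup X] [NormedSpace ℂ X] {e : ℕ → X} {ℓ : ℕ → StrongDual ℂ X}

/-- For a form that depends on the first `n` coordinates, `ζ` meets finitely many terms in each
variable, and the Aron–Berner extension becomes plain evaluation. -/
theorem aronBerner_truncL (H : IsCZeroBasis e ℓ) {ζ : StrongDual ℂ (StrongDual ℂ X)} {z : ℕ → ℂ}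
    (hζ : ∀ φ : StrongDual ℂ X, ζ φ = ∑' n, z n * φ (e n)) {m : ℕ} (n : ℕ) (a : MForm X m) :
    aronBerner ζ m (MForm.truncL e ℓ m n a) = a fun _ => seqTrunc e n z := by
  induction m with
  | zero =>
    change MForm.truncL e ℓ 0 n a 0 = _
    rw [MForm.truncL_apply]
    congr 1
    ext k
    exact k.elim0
  | succ m ih =>
    rw [aronBerner_succ, hζ]
    have hproj : ∀ j, basisProj e ℓ n (e j) = if j < n then e j else 0 := by
      intro j
      refine H.ext fun k => ?_
      rw [H.coord_basisProj]
      split_ifs with h1 h2 h2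
      · rfl
      · rw [map_zero, H.coord_unit, if_neg (by omega)]
      · rw [H.coord_unit, if_neg (by omega)]
      · rw [map_zero]
    have hterm : ∀ j, z j * ((aronBerner ζ m).comp (MForm.truncL e ℓ (m + 1) n a).curryLeft) (e j) =
        if j < n then z j * a.curryLeft (e j) (fun _ => seqTrunc e n z) else 0 := by
      intro j
      rw [ContinuousLinearMap.comp_apply, MForm.curryLeft_truncL, ih, hproj]
      split_ifs
      · rfl
      · simp
    simp_rw [hterm]
    rw [tsum_eq_sum (s := Finset.range n) (by
      intro j hj
      rw [if_neg (by simpa using hj)])]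
    have h1 : ∑ j ∈ Finset.range n,
        (if j < n then z j * a.curryLeft (e j) (fun _ => seqTrunc e n z) else 0) =
        ∑ j ∈ Finset.range n, z j * a.curryLeft (e j) (fun _ => seqTrunc e n z) :=
      Finset.sum_congr rfl fun j hj => if_pos (Finset.mem_range.1 hj)
    have h2 : a.curryLeft (seqTrunc e n z) (fun _ => seqTrunc e n z) =
        ∑ j ∈ Finset.range n, z j * a.curryLeft (e j) (fun _ => seqTrunc e n z) := by
      conv_lhs => rw [show seqTrunc e n z = ∑ i ∈ Finset.range n, z i • e i from rfl]
      rw [map_sum, _root_.sum_apply]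
      refine Finset.sum_congr rfl fun j _ => ?_
      rw [map_smul]
      rfl
    rw [h1, ← h2, ContinuousMultilinearMap.curryLeft_apply]
    congr 1
    ext k
    refine Fin.cases ?_ (fun k => ?_) k <;> simp

/-- The extension is continuous in the form, so norm approximation by truncations expresses it
through values at points of `X`. -/
theorem tendsto_aronBerner (H : IsCZeroBasis e ℓ) {ζ : StrongDual ℂ (StrongDual ℂ X)} {z : ℕ → ℂ}
    (hζ : ∀ φ : StrongDual ℂ X, ζ φ = ∑' n, z n * φ (e n)) {m : ℕ} (a : MForm X m) :
    Tendsto (fun n => a fun _ => seqTrunc e n z) atTop (𝓝 (aronBerner ζ m a)) := by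
  refine (((aronBerner ζ m).continuous.tendsto a).comp (tendsto_truncL H m a)).congr fun n => ?_
  exact aronBerner_truncL H hζ n a

/-- Cauchy's estimate provides a geometric majorant that does not depend on the truncation order, so
limit and sum may be exchanged. -/
theorem exists_hasSum_taylorExt (H : IsCZeroBasis e ℓ) {ζ : StrongDual ℂ (StrongDual ℂ X)}
    {z : ℕ → ℂ} (hζ : ∀ φ : StrongDual ℂ X, ζ φ = ∑' n, z n * φ (e n)) {ρ : ℝ} (hρ : ρ < 1)
    (hz : ∀ k, ‖z k‖ ≤ ρ) (f : Au X) :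
    ∃ L, HasSum (taylorExt f.1 ζ) L ∧
      Tendsto (fun n => zeroExt f.1 (seqTrunc e n z)) atTop (𝓝 L) := by
  have hρ0 : 0 ≤ ρ := (norm_nonneg _).trans (hz 0)
  have hE : ∀ m, taylorExt f.1 ζ m = aronBerner ζ m (taylorForm (zeroExt f.1) m) := by
    intro m
    rw [taylorForm, map_smul]
    rfl
  have hlim : ∀ m, Tendsto (fun n => taylorForm (zeroExt f.1) m fun _ => seqTrunc e n z) atTop
      (𝓝 (taylorExt f.1 ζ m)) := fun m => by
    rw [hE]
    exact tendsto_aronBerner H hζ _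
  -- A radius with `1 < s` and `s * ρ < 1`; this choice needs no separate case `ρ = 0`.
  set s : ℝ := 2 / (1 + ρ) with hs
  have hs1 : 1 < s := by rw [hs, lt_div_iff₀ (by linarith)]; linarith
  have hsρ : s * ρ < 1 := by
    rw [hs, div_mul_eq_mul_div, div_lt_one (by linarith)]; linarith
  have hnorm : ∀ n, ‖seqTrunc e n z‖ ≤ ρ := H.norm_seqTrunc_le hρ0 hz
  have hbound : ∀ n m, ‖taylorForm (zeroExt f.1) m fun _ => seqTrunc e n z‖ ≤ ‖f‖ / s ^ m :=
    fun n m => norm_taylorForm_le (Au.analytic f) (Au.norm_zeroExt_le f) (by positivity)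
      (lt_of_le_of_lt (by gcongr; exact hnorm n) hsρ) m
  have hsum : Summable fun m : ℕ => ‖f‖ / s ^ m := by
    simp_rw [div_eq_mul_inv, ← inv_pow]
    exact (summable_geometric_of_lt_one (by positivity) (inv_lt_one_of_one_lt₀ hs1)).mul_left _
  have hE' : ∀ m, ‖taylorExt f.1 ζ m‖ ≤ ‖f‖ / s ^ m := fun m =>
    le_of_tendsto (hlim m).norm (Eventually.of_forall fun n => hbound n m)
  refine ⟨_, (Summable.of_norm_bounded hsum hE').hasSum, ?_⟩
  refine (tendsto_tsum_of_dominated_convergence hsum hlim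
    (Eventually.of_forall fun n => hbound n)).congr fun n => ?_
  exact (hasSum_taylorForm (Au.analytic f) ((hnorm n).trans_lt hρ)).tsum_eq

end AronBerner

/-! ### Characters -/

section Characters

/-- Multiplicativity bounds all powers of `‖φ f‖` by `‖toDual φ‖` times those of `‖f‖`, which is
impossible if the ratio exceeds 1. Completeness of the algebra does not enter. -/
theorem character_norm_apply_le {A : Type*} [NormedRing A] [NormedAlgebra ℂ A]
    (φ : characterSpace ℂ A) (f : A) : ‖φ f‖ ≤ ‖f‖ := by
  by_contra! h
  have hbound : ∀ n : ℕ, ‖φ f‖ ^ (n + 1) ≤ ‖toDual φ‖ * ‖f‖ ^ (n + 1) := by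
    intro n
    rw [← norm_pow, ← map_pow]
    refine ((toDual φ).le_opNorm (f ^ (n + 1))).trans ?_
    gcongr
    exact norm_pow_le' f n.succ_pos
  have hf : 0 < ‖f‖ := by
    rw [norm_pos_iff]
    rintro rfl
    simp at h
  have h1 : 1 < ‖φ f‖ / ‖f‖ := by rwa [one_lt_div hf]
  obtain ⟨n, hn⟩ := ((tendsto_pow_atTop_atTop_of_one_lt h1).comp
    (tendsto_add_atTop_nat 1)).eventually_gt_atTop ‖toDual φ‖ |>.exists
  simp only [Function.comp_apply, div_pow] at hn
  rw [lt_div_iff₀ (by positivity)] at hn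
  exact absurd (hbound n) (not_le.2 hn)

variable {X : Type*} [NormedAddCommGroup X] [NormedSpace ℂ X]

/-- The limit of evaluations at a sequence of points along the hyperfilter. -/
theorem exists_limit_character (p : ℕ → ball (0 : X) 1) :
    ∃ φ : characterSpace ℂ (Au X),
      ∀ f : Au X, Tendsto (fun n => f.1 (p n)) (hyperfilter ℕ) (𝓝 (φ f)) := by
  have hex : ∀ f : Au X, ∃ L : ℂ, ‖L‖ ≤ ‖f‖ ∧
      Tendsto (fun n => f.1 (p n)) (hyperfilter ℕ) (𝓝 L) := by
    intro f
    -- Bounded values converge along an ultrafilter for all `f` at once, and algebraic identities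
    -- pass to the limit.
    obtain ⟨L, hL, hle⟩ := (isCompact_closedBall (0 : ℂ) ‖f‖).ultrafilter_le_nhds
      ((hyperfilter ℕ).map fun n => f.1 (p n)) (by
        rw [Ultrafilter.coe_map, le_principal_iff, mem_map]
        exact univ_mem' fun n =>
          mem_closedBall_zero_iff.2 (Au.norm_apply_le f (p n)))
    exact ⟨L, mem_closedBall_zero_iff.1 hL, hle⟩
  choose L hL hlim using hex
  let Λ : StrongDual ℂ (Au X) := LinearMap.mkContinuous
    { toFun := L
      map_add' := fun f g => tendsto_nhds_unique (hlim (f + g)) ((hlim f).add (hlim g))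
      map_smul' := fun c f => tendsto_nhds_unique (hlim (c • f)) ((hlim f).const_smul c) } 1
    fun f => by rw [one_mul]; exact hL f
  refine ⟨⟨StrongDual.toWeakDual Λ, ?_, ?_⟩, hlim⟩
  · intro h
    have h1 : L 1 = 0 := DFunLike.congr_fun h (1 : Au X)
    have h2 : L 1 = 1 := tendsto_nhds_unique (hlim 1) tendsto_const_nhds
    exact one_ne_zero (h2.symm.trans h1)
  · intro f g
    exact tendsto_nhds_unique (hlim (f * g)) ((hlim f).mul (hlim g))

end Characters

/-! ### Point evaluations -/

/-- The coordinate functionals of `c₀`. -/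
def CZero.coordL (n : ℕ) : StrongDual ℂ CZero :=
  LinearMap.mkContinuous
    { toFun := fun x : CZero => x n
      map_add' := fun _ _ => rfl
      map_smul' := fun _ _ => rfl } 1 (fun x => by
        rw [one_mul, ← ZeroAtInftyContinuousMap.norm_toBCF_eq_norm]
        exact x.toBCF.norm_coe_le_norm n)

theorem isCZeroBasis_unitVec : IsCZeroBasis unitVec CZero.coordL where
  coord_unit i j := by
    change (Pi.single j (1 : ℂ) : ℕ → ℂ) i = _
    rw [Pi.single_apply]
  norm_coord_le i x := by
    rw [← ZeroAtInftyContinuousMap.norm_toBCF_eq_norm]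
    exact x.toBCF.norm_coe_le_norm i
  norm_le x C hC h := by
    rw [← ZeroAtInftyContinuousMap.norm_toBCF_eq_norm, BoundedContinuousFunction.norm_le hC]
    exact h
  tendsto_coord x := by
    have := x.zero_at_infty'
    rwa [Filter.cocompact_eq_cofinite, Nat.cofinite_eq_atTop] at this

theorem LInf.norm_apply_le (z : LInf) (k : ℕ) : ‖z k‖ ≤ ‖z‖ :=
  lp.norm_apply_le_norm ENNReal.top_ne_zero z k

theorem ClosedBallLInf.norm_apply_le (z : ClosedBallLInf) (k : ℕ) : ‖z.1 k‖ ≤ 1 :=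
  (LInf.norm_apply_le z.1 k).trans (mem_closedBall_zero_iff.1 z.2)

/-- The scalars that push points of the closed ball inside. -/
def shrink (n : ℕ) : ℝ := 1 - 1 / (n + 2)

theorem shrink_nonneg (n : ℕ) : 0 ≤ shrink n := by
  rw [shrink, sub_nonneg, div_le_one (by positivity)]
  linarith [n.cast_nonneg (α := ℝ)]

theorem shrink_lt_one (n : ℕ) : shrink n < 1 := by
  rw [shrink, sub_lt_self_iff]
  positivity

theorem tendsto_shrink : Tendsto shrink atTop (𝓝 1) := by
  have : Tendsto (fun n : ℕ => (1 : ℝ) / ((n : ℝ) + 2)) atTop (𝓝 0) :=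
    tendsto_const_nhds.div_atTop (tendsto_atTop_add_const_right _ _ tendsto_natCast_atTop_atTop)
  have h := this.const_sub 1
  rwa [sub_zero] at h

theorem norm_shrink_smul_lt_one {X : Type*} [NormedAddCommGroup X] [NormedSpace ℂ X] {x : X}
    (hx : ‖x‖ ≤ 1) (n : ℕ) : ‖(shrink n : ℂ) • x‖ < 1 := by
  rw [norm_smul, Complex.norm_real, Real.norm_of_nonneg (shrink_nonneg n)]
  exact lt_of_le_of_lt (mul_le_of_le_one_right (shrink_nonneg n) hx) (shrink_lt_one n)

theorem norm_sub_shrink_smul_le {X : Type*} [NormedAddCommGroup X] [NormedSpace ℂ X] {x : X}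
    (hx : ‖x‖ ≤ 1) (n : ℕ) : ‖x - (shrink n : ℂ) • x‖ ≤ 1 - shrink n := by
  have h2 : x - (shrink n : ℂ) • x = ((1 - shrink n : ℝ) : ℂ) • x := by
    push_cast
    rw [sub_smul, one_smul]
  have h3 : 0 ≤ 1 - shrink n := by linarith [shrink_lt_one n]
  rw [h2, norm_smul, Complex.norm_real, Real.norm_of_nonneg h3]
  exact mul_le_of_le_one_right h3 hx

/-- Points of the ball of `c₀` that approximate a point of the closed ball of `ℓ_∞`. -/
def approxPt (z : ClosedBallLInf) (n : ℕ) : ball (0 : CZero) 1 :=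
  ⟨(shrink n : ℂ) • seqTrunc unitVec n z.1, by
    rw [mem_ball_zero_iff]
    exact norm_shrink_smul_lt_one
      (isCZeroBasis_unitVec.norm_seqTrunc_le zero_le_one z.norm_apply_le n) n⟩

/-- The evaluation `δ_z` at a point of the closed ball of `ℓ_∞`. -/
def pointEval (z : ClosedBallLInf) : SpecC0 := (exists_limit_character (approxPt z)).choose

theorem tendsto_pointEval (z : ClosedBallLInf) (f : Au CZero) :
    Tendsto (fun n => f.1 (approxPt z n)) (hyperfilter ℕ) (𝓝 (pointEval z f)) :=
  (exists_limit_character (approxPt z)).choose_spec f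

/-- The ultrafilter serves only the construction: wherever an ordinary limit exists, it is the
value. -/
theorem pointEval_eq_of_tendsto {z : ClosedBallLInf} {f : Au CZero} {L : ℂ}
    (h : Tendsto (fun n => f.1 (approxPt z n)) atTop (𝓝 L)) : pointEval z f = L :=
  tendsto_nhds_unique (tendsto_pointEval z f) (h.mono_left Nat.hyperfilter_le_atTop)

theorem coord_approxPt (z : ClosedBallLInf) (n k : ℕ) :
    CZero.coordL k (approxPt z n : CZero) = shrink n * if k < n then z.1 k else 0 := by
  change CZero.coordL k ((shrink n : ℂ) • seqTrunc unitVec n z.1) = _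
  rw [map_smul, isCZeroBasis_unitVec.coord_seqTrunc, smul_eq_mul]

theorem tendsto_coord_approxPt (z : ClosedBallLInf) (k : ℕ) :
    Tendsto (fun n => CZero.coordL k (approxPt z n : CZero)) atTop (𝓝 (z.1 k)) := by
  have h1 : Tendsto (fun n => (shrink n : ℂ) * z.1 k) atTop (𝓝 (((1 : ℝ) : ℂ) * z.1 k)) :=
    ((Complex.continuous_ofReal.tendsto _).comp tendsto_shrink).mul_const _
  rw [Complex.ofReal_one, one_mul] at h1
  refine h1.congr' ?_
  filter_upwards [eventually_gt_atTop k] with n hn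
  rw [coord_approxPt, if_pos hn]

theorem pointEval_coord (z : ClosedBallLInf) (k : ℕ) :
    pointEval z (Au.ofDual (CZero.coordL k)) = z.1 k :=
  pointEval_eq_of_tendsto (tendsto_coord_approxPt z k)

theorem pointEval_injective : Function.Injective pointEval := by
  intro z w h
  ext k
  rw [← pointEval_coord z, ← pointEval_coord w, h]

/-- Truncation and shrinking with a common index contract distances, so a modulus of continuity of
`f` on the ball passes to `z ↦ pointEval z f`. -/
theorem norm_approxPt_sub_le (z w : ClosedBallLInf) (n : ℕ) :
    dist (approxPt z n) (approxPt w n) ≤ dist z w := by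
  rw [Subtype.dist_eq, Subtype.dist_eq, dist_eq_norm, dist_eq_norm]
  refine isCZeroBasis_unitVec.norm_le _ _ (norm_nonneg _) fun k => ?_
  rw [map_sub, coord_approxPt, coord_approxPt, ← mul_sub, norm_mul, Complex.norm_real,
    Real.norm_of_nonneg (shrink_nonneg n)]
  refine (mul_le_of_le_one_left (norm_nonneg _) (shrink_lt_one n).le).trans ?_
  split_ifs
  · exact LInf.norm_apply_le (z.1 - w.1) k
  · simp

theorem uniformContinuous_pointEval (f : Au CZero) :
    UniformContinuous fun z : ClosedBallLInf => pointEval z f := by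
  rw [Metric.uniformContinuous_iff]
  intro ε hε
  obtain ⟨d, hd, h⟩ := (Metric.uniformContinuous_iff.1 f.2.1) (ε / 2) (half_pos hε)
  refine ⟨d, hd, fun z w hzw => lt_of_le_of_lt ?_ (half_lt_self hε)⟩
  refine le_of_tendsto ((tendsto_pointEval z f).dist (tendsto_pointEval w f)) ?_
  exact Eventually.of_forall fun n => (h ((norm_approxPt_sub_le z w n).trans_lt hzw)).le

/-- Inside the open ball the values at unshrunk truncations already converge to the Taylor sum. The
shrunk points are within `1 - shrink n` of them, and uniform continuity identifies the two limits.
-/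
theorem hasSum_taylorExt_pointEval (f : Au CZero) (w : OpenBallLInf) :
    HasSum (taylorExt f.1 (toBidual w.1)) (pointEval w.toClosed f) := by
  have hw : ‖w.1‖ < 1 := mem_ball_zero_iff.1 w.2
  have hwk : ∀ k, ‖w.1 k‖ ≤ ‖w.1‖ := LInf.norm_apply_le w.1
  obtain ⟨L, hL, hlim⟩ := exists_hasSum_taylorExt isCZeroBasis_unitVec (ζ := toBidual w.1)
    (z := w.1) (fun φ => rfl) hw hwk f
  have hP : ∀ n, seqTrunc unitVec n w.1 ∈ ball (0 : CZero) 1 := fun n => by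
    rw [mem_ball_zero_iff]
    exact (isCZeroBasis_unitVec.norm_seqTrunc_le (norm_nonneg _) hwk n).trans_lt hw
  have hdist : Tendsto (fun n => dist (approxPt w.toClosed n) ⟨seqTrunc unitVec n w.1, hP n⟩) atTop
      (𝓝 0) := by
    have h1 : Tendsto (fun n => 1 - shrink n) atTop (𝓝 0) := by
      simpa using tendsto_shrink.const_sub 1
    refine squeeze_zero (fun _ => dist_nonneg) (fun n => ?_) h1
    rw [Subtype.dist_eq, dist_comm, dist_eq_norm]
    change ‖seqTrunc unitVec n w.1 - (shrink n : ℂ) • seqTrunc unitVec n w.1‖ ≤ _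
    exact norm_sub_shrink_smul_le (mem_ball_zero_iff.1 (hP n)).le n
  have hfd : Tendsto (fun n => dist (f.1 (approxPt w.toClosed n))
      (zeroExt f.1 (seqTrunc unitVec n w.1))) atTop (𝓝 0) := by
    simp_rw [zeroExt_eq _ (hP _)]
    rw [Metric.tendsto_atTop] at hdist ⊢
    intro ε hε
    obtain ⟨d, hd, h⟩ := (Metric.uniformContinuous_iff.1 f.2.1) ε hε
    obtain ⟨N, hN⟩ := hdist d hd
    refine ⟨N, fun n hn => ?_⟩
    have := hN n hn
    rw [Real.dist_0_eq_abs, abs_of_nonneg dist_nonneg] at this ⊢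
    exact h this
  have : pointEval w.toClosed f = L :=
    pointEval_eq_of_tendsto ((tendsto_iff_of_dist hfd).2 hlim)
  rwa [this]

theorem isPointEvaluation_pointEval : IsPointEvaluation pointEval := fun f =>
  ⟨uniformContinuous_pointEval f, hasSum_taylorExt_pointEval f⟩

/-- Every character is the evaluation at a point of the closed ball of `ℓ_∞`. -/
theorem exists_eq_pointEval (φ : SpecC0) : ∃ z : ClosedBallLInf, φ = pointEval z := by
  have hle : ∀ n, ‖φ (Au.ofDual (CZero.coordL n))‖ ≤ 1 := by
    intro n
    refine (character_norm_apply_le φ _).trans (Au.norm_le_of_forall fun x => ?_)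
    rw [Au.ofDual_apply]
    exact (isCZeroBasis_unitVec.norm_coord_le n x).trans (mem_ball_zero_iff.1 x.2).le
  let z : LInf := ⟨fun n => φ (Au.ofDual (CZero.coordL n)), memℓp_infty ⟨1, by
    rintro _ ⟨n, rfl⟩
    exact hle n⟩⟩
  have hz : z ∈ closedBall (0 : LInf) 1 := by
    rw [mem_closedBall_zero_iff]
    exact lp.norm_le_of_forall_le zero_le_one hle
  refine ⟨⟨z, hz⟩, character_ext isCZeroBasis_unitVec fun n => ?_⟩
  rw [pointEval_coord]

/-! ### The pseudo-hyperbolic distance -/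

section PseudoHyp

variable {A : Type*} [NormedRing A] [NormedAlgebra ℂ A]

theorem norm_le_pseudoHyp (φ ψ : characterSpace ℂ A) {f : A} (hf : ‖f‖ ≤ 1) (h : ψ f = 0) :
    ‖φ f‖ ≤ pseudoHyp φ ψ := by
  refine le_csSup ⟨1, ?_⟩ ⟨f, hf, h, rfl⟩
  rintro _ ⟨g, hg, -, rfl⟩
  exact (character_norm_apply_le φ g).trans hg

theorem pseudoHyp_nonneg (φ ψ : characterSpace ℂ A) : 0 ≤ pseudoHyp φ ψ :=
  (norm_nonneg _).trans (norm_le_pseudoHyp φ ψ (f := 0) (by simp) (map_zero ψ))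

theorem pseudoHyp_le {φ ψ : characterSpace ℂ A} {ρ : ℝ}
    (h : ∀ f : A, ‖f‖ ≤ 1 → ψ f = 0 → ‖φ f‖ ≤ ρ) : pseudoHyp φ ψ ≤ ρ := by
  refine csSup_le ⟨_, 0, by simp, map_zero ψ, rfl⟩ ?_
  rintro _ ⟨f, hf, hf0, rfl⟩
  exact h f hf hf0

theorem norm_le_pseudoHyp_mul (φ ψ : characterSpace ℂ A) {f : A} (h : ψ f = 0) :
    ‖φ f‖ ≤ pseudoHyp φ ψ * ‖f‖ := by
  rcases (norm_nonneg f).eq_or_lt with h0 | h0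
  · rw [← h0, mul_zero, norm_eq_zero.1 h0.symm, map_zero, norm_zero]
  · have h1 := norm_le_pseudoHyp φ ψ (f := (‖f‖ : ℂ)⁻¹ • f)
      (by rw [norm_smul, norm_inv, Complex.norm_real, norm_norm, inv_mul_cancel₀ h0.ne'])
      (by rw [map_smul, h, smul_zero])
    rw [map_smul, norm_smul, norm_inv, Complex.norm_real, norm_norm, inv_mul_le_iff₀ h0] at h1
    linarith

theorem gleasonDist_le_of_forall {φ ψ : characterSpace ℂ A} {D : ℝ} (hD : 0 ≤ D)
    (h : ∀ f, ‖φ f - ψ f‖ ≤ D * ‖f‖) : gleasonDist φ ψ ≤ D :=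
  ContinuousLinearMap.opNorm_le_bound _ hD h

theorem norm_sub_le_gleasonDist_mul (φ ψ : characterSpace ℂ A) (f : A) :
    ‖φ f - ψ f‖ ≤ gleasonDist φ ψ * ‖f‖ :=
  (toDual φ - toDual ψ).le_opNorm f

/-- Subtracting the constant `ψ f` produces a zero at `ψ` and at most doubles the norm. -/
theorem gleasonDist_le_two_mul_pseudoHyp {X : Type*} [NormedAddCommGroup X] [NormedSpace ℂ X]
    (φ ψ : characterSpace ℂ (Au X)) : gleasonDist φ ψ ≤ 2 * pseudoHyp φ ψ := by
  refine gleasonDist_le_of_forall (mul_nonneg zero_le_two (pseudoHyp_nonneg _ _)) fun f => ?_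
  set c : Au X := algebraMap ℂ (Au X) (ψ f) with hc
  have hcn : ‖c‖ ≤ ‖f‖ := Au.norm_le_of_forall fun x => character_norm_apply_le ψ f
  have h1 : φ c = ψ f := AlgHomClass.commutes φ (ψ f)
  have h2 : ψ c = ψ f := AlgHomClass.commutes ψ (ψ f)
  have h3 := norm_le_pseudoHyp_mul φ ψ (f := f - c) (by rw [map_sub, h2, sub_self])
  rw [map_sub, h1] at h3
  refine h3.trans ?_
  have h4 : ‖f - c‖ ≤ 2 * ‖f‖ := (norm_sub_le _ _).trans (by linarith)
  calc pseudoHyp φ ψ * ‖f - c‖ ≤ pseudoHyp φ ψ * (2 * ‖f‖) :=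
        mul_le_mul_of_nonneg_left h4 (pseudoHyp_nonneg _ _)
    _ = 2 * pseudoHyp φ ψ * ‖f‖ := by ring

end PseudoHyp

/-! ### Analytic discs -/

/-- The point of the closed ball of `ℓ_∞` with given coordinates. -/
def ClosedBallLInf.mk (w : ℕ → ℂ) (hw : ∀ n, ‖w n‖ ≤ 1) : ClosedBallLInf :=
  ⟨⟨w, memℓp_infty ⟨1, by rintro _ ⟨n, rfl⟩; exact hw n⟩⟩, by
    rw [mem_closedBall_zero_iff]
    exact lp.norm_le_of_forall_le zero_le_one hw⟩

theorem ClosedBallLInf.ext {z w : ClosedBallLInf} (h : ∀ n, z.1 n = w.1 n) : z = w := by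
  ext n
  exact h n

/-- Holomorphy is inherited by polynomials in the coordinates, and their approximation of `f` is
uniform in `t` because characters are contractions. -/
theorem differentiableOn_pointEval {h : ℂ → ClosedBallLInf}
    (hh : ∀ n, DifferentiableOn ℂ (fun t => (h t).1 n) (ball 0 1)) (f : Au CZero) :
    DifferentiableOn ℂ (fun t => pointEval (h t) f) (ball 0 1) := by
  have hpoly : ∀ q ∈ coordPoly CZero.coordL,
      DifferentiableOn ℂ (fun t => pointEval (h t) q) (ball 0 1) := by
    intro q hq
    induction hq using Algebra.adjoin_induction with
    | mem x hx =>
      obtain ⟨n, rfl⟩ := hx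
      simpa only [pointEval_coord] using hh n
    | algebraMap c =>
      refine (differentiableOn_const c).congr fun t _ => ?_
      exact AlgHomClass.commutes (pointEval (h t)) c
    | add x y _ _ hx hy => simpa only [map_add] using hx.fun_add hy
    | mul x y _ _ hx hy => simpa only [map_mul] using hx.fun_mul hy
  choose q hq hfq using fun n : ℕ => exists_coordPoly_norm_sub_le isCZeroBasis_unitVec f
    (ε := 1 / ((n : ℝ) + 1)) (by positivity)
  refine TendstoLocallyUniformlyOn.differentiableOn (φ := atTop)
    (F := fun n t => pointEval (h t) (q n)) ?_ (Eventually.of_forall fun n => hpoly _ (hq n))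
    isOpen_ball
  refine TendstoUniformlyOn.tendstoLocallyUniformlyOn ?_
  rw [Metric.tendstoUniformlyOn_iff]
  intro ε hε
  filter_upwards [tendsto_one_div_add_atTop_nhds_zero_nat.eventually (gt_mem_nhds hε)] with n hn t _
  rw [dist_eq_norm, ← map_sub]
  exact ((character_norm_apply_le _ _).trans (hfq n)).trans_lt hn

/-- The Schwarz lemma for an analytic disc through two points. -/
theorem pseudoHyp_pointEval_le_of_disc {h : ℂ → ℕ → ℂ}
    (hh : ∀ n, DifferentiableOn ℂ (fun t => h t n) (ball 0 1))
    (hb : ∀ t ∈ ball (0 : ℂ) 1, ∀ n, ‖h t n‖ ≤ 1) {c : ℂ} (hc : ‖c‖ < 1) {z w : ClosedBallLInf}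
    (hz : ∀ n, z.1 n = h c n) (hw : ∀ n, w.1 n = h 0 n) :
    pseudoHyp (pointEval z) (pointEval w) ≤ ‖c‖ := by
  classical
  -- The value off the disc is irrelevant and only makes the curve total.
  let g : ℂ → ClosedBallLInf := fun t =>
    if ht : t ∈ ball (0 : ℂ) 1 then ClosedBallLInf.mk (h t) (hb t ht)
    else ClosedBallLInf.mk 0 (by simp)
  have hg : ∀ t (ht : t ∈ ball (0 : ℂ) 1), g t = ClosedBallLInf.mk (h t) (hb t ht) :=
    fun t ht => dif_pos ht
  have hgd : ∀ n, DifferentiableOn ℂ (fun t => (g t).1 n) (ball 0 1) := fun n =>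
    (hh n).congr fun t ht => by rw [hg t ht]; rfl
  have h0 : (0 : ℂ) ∈ ball (0 : ℂ) 1 := mem_ball_self one_pos
  have hc' : c ∈ ball (0 : ℂ) 1 := mem_ball_zero_iff.2 hc
  have hgz : g c = z := by
    rw [hg c hc']; exact ClosedBallLInf.ext fun n => (hz n).symm
  have hgw : g 0 = w := by
    rw [hg 0 h0]; exact ClosedBallLInf.ext fun n => (hw n).symm
  refine pseudoHyp_le fun f hf hf0 => ?_
  have := Complex.norm_le_norm_of_mapsTo_ball (differentiableOn_pointEval hgd f) (R := 1)
    (fun t _ => mem_closedBall_zero_iff.2 ((character_norm_apply_le _ _).trans hf))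
    (by rw [hgw]; exact hf0) hc
  rwa [hgz] at this

/-! ### Möbius transformations -/

/-- The identity behind Schwarz–Pick. It turns `|a - b| ≤ ρ |1 - b̄a|` into an inequality without
division that still makes sense on the unit circle. -/
theorem norm_one_sub_conj_mul_sq_sub (a b : ℂ) :
    ‖1 - star b * a‖ ^ 2 - ‖a - b‖ ^ 2 = (1 - ‖a‖ ^ 2) * (1 - ‖b‖ ^ 2) := by
  simp only [Complex.sq_norm, Complex.normSq_apply, Complex.star_def, Complex.sub_re,
    Complex.sub_im, Complex.mul_re, Complex.mul_im, Complex.conj_re, Complex.conj_im,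
    Complex.one_re, Complex.one_im]
  ring

theorem norm_sub_le_norm_one_sub {a b : ℂ} (ha : ‖a‖ ≤ 1) (hb : ‖b‖ ≤ 1) :
    ‖a - b‖ ≤ ‖1 - star b * a‖ := by
  have h := norm_one_sub_conj_mul_sq_sub a b
  have h1 : 0 ≤ (1 - ‖a‖ ^ 2) * (1 - ‖b‖ ^ 2) := by
    refine mul_nonneg ?_ ?_ <;> rw [sub_nonneg] <;> exact pow_le_one₀ (norm_nonneg _) ‹_›
  exact le_of_sq_le_sq (by linarith) (norm_nonneg _)

theorem eq_of_star_mul_eq_one {a b : ℂ} (ha : ‖a‖ ≤ 1) (hb : ‖b‖ ≤ 1) (h : 1 - star b * a = 0) :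
    a = b := by
  have := norm_sub_le_norm_one_sub ha hb
  rw [h, norm_zero] at this
  exact sub_eq_zero.1 (norm_le_zero_iff.1 this)

theorem one_sub_star_mul_ne_zero {a b : ℂ} (ha : ‖a‖ ≤ 1) (hb : ‖b‖ < 1) :
    1 - star b * a ≠ 0 := by
  intro h
  have h1 : ‖star b * a‖ = 1 := by rw [← sub_eq_zero.1 h, norm_one]
  rw [norm_mul, norm_star] at h1
  nlinarith [norm_nonneg a, norm_nonneg b]

theorem mul_one_add_moebius {a b s : ℂ} (h : 1 - s * a ≠ 0) :
    a * (1 + s * ((a - b) / (1 - s * a))) = (a - b) / (1 - s * a) + b := by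
  have h1 : (a - b) / (1 - s * a) * (1 - s * a) = a - b := div_mul_cancel₀ _ h
  linear_combination -h1

/-- If the coordinates of two points satisfy the Schwarz–Pick inequality with the same constant
`ρ`, then the pseudo-hyperbolic distance of the evaluations is at most `ρ`. -/
theorem pseudoHyp_pointEval_le {z w : ClosedBallLInf} {ρ : ℝ} (hρ0 : 0 < ρ) (hρ1 : ρ < 1)
    (h : ∀ n, (1 - ρ ^ 2) * ‖1 - star (w.1 n) * z.1 n‖ ^ 2 ≤
      (1 - ‖z.1 n‖ ^ 2) * (1 - ‖w.1 n‖ ^ 2)) :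
    pseudoHyp (pointEval z) (pointEval w) ≤ ρ := by
  have hρn : ‖(ρ : ℂ)‖ = ρ := by rw [Complex.norm_real, Real.norm_of_nonneg hρ0.le]
  -- The Möbius image of `z n`, with `w n` sent to 0, divided by `ρ`; the hypothesis bounds it by 1.
  -- Applying the inverse Möbius map to `κ n * t` gives a disc through `w` at `t = 0` and `z` at `t
  -- = ρ`.
  let κ : ℕ → ℂ := fun n => (z.1 n - w.1 n) / (1 - star (w.1 n) * z.1 n) / ρ
  have hκ : ∀ n, ‖κ n‖ ≤ 1 := by
    intro n
    simp only [κ]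
    rw [norm_div, norm_div, hρn, div_le_one hρ0]
    refine div_le_of_le_mul₀ (norm_nonneg _) hρ0.le ?_
    refine le_of_sq_le_sq ?_ (by positivity)
    have h1 := norm_one_sub_conj_mul_sq_sub (z.1 n) (w.1 n)
    have h2 := h n
    nlinarith
  have hκt : ∀ n, ∀ t ∈ ball (0 : ℂ) 1, ‖κ n * t‖ < 1 := by
    intro n t ht
    rw [mem_ball_zero_iff] at ht
    rw [norm_mul]
    exact lt_of_le_of_lt (mul_le_of_le_one_left (norm_nonneg _) (hκ n)) ht
  have hden : ∀ n, ∀ t ∈ ball (0 : ℂ) 1, 1 + star (w.1 n) * (κ n * t) ≠ 0 := by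
    intro n t ht h0
    have h1 := one_sub_star_mul_ne_zero (a := -star (w.1 n)) (b := star (κ n * t))
      (by rw [norm_neg, norm_star]; exact w.norm_apply_le n)
      (by rw [norm_star]; exact hκt n t ht)
    apply h1
    rw [star_star, ← h0]
    ring
  have := pseudoHyp_pointEval_le_of_disc (z := z) (w := w) (c := ρ)
    (h := fun t n => (κ n * t + w.1 n) / (1 + star (w.1 n) * (κ n * t)))
    (fun n => DifferentiableOn.fun_div (by fun_prop) (by fun_prop) (hden n)) ?_ (by rwa [hρn]) ?_ ?_
  · rwa [hρn] at this
  · intro t ht n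
    rw [norm_div]
    refine div_le_one_of_le₀ ?_ (norm_nonneg _)
    have := norm_sub_le_norm_one_sub (a := κ n * t) (b := -w.1 n) (hκt n t ht).le
      (by rw [norm_neg]; exact w.norm_apply_le n)
    simpa using this
  · intro n
    -- At a common unimodular coordinate `κ n = 0` and the disc is constant.
    by_cases h0 : 1 - star (w.1 n) * z.1 n = 0
    · have hzw := eq_of_star_mul_eq_one (z.norm_apply_le n) (w.norm_apply_le n) h0
      simp [κ, hzw]
    · have hκρ : κ n * ρ = (z.1 n - w.1 n) / (1 - star (w.1 n) * z.1 n) := by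
        simp only [κ]
        rw [div_mul_cancel₀]
        exact_mod_cast hρ0.ne'
      have hd := hden n ρ (mem_ball_zero_iff.2 (by rwa [hρn]))
      rw [eq_div_iff hd, hκρ]
      exact mul_one_add_moebius h0
  · intro n
    simp

/-! ### Functions of one coordinate -/

/-- A holomorphic function of the `n`-th coordinate. -/
theorem exists_au_of_coord {U : Set ℂ} (hU : IsOpen U) (hU1 : closedBall 0 1 ⊆ U) {G : ℂ → ℂ}
    (hG : DifferentiableOn ℂ G U) (hG1 : ∀ t ∈ closedBall (0 : ℂ) 1, ‖G t‖ ≤ 1) (n : ℕ) :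
    ∃ f : Au CZero, ‖f‖ ≤ 1 ∧ ∀ z : ClosedBallLInf, pointEval z f = G (z.1 n) := by
  have hmaps : MapsTo (CZero.coordL n) (ball 0 1) (closedBall 0 1) := fun x hx => by
    rw [mem_ball_zero_iff] at hx
    rw [mem_closedBall_zero_iff]
    exact (isCZeroBasis_unitVec.norm_coord_le n x).trans hx.le
  have hGc : ContinuousOn G (closedBall 0 1) := hG.continuousOn.mono hU1
  let f : Au CZero := Au.ofFun (fun x => G (CZero.coordL n x))
    ((hG.analyticOnNhd hU).comp ((CZero.coordL n).analyticOnNhd _) (hmaps.mono_right hU1))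
    (((ProperSpace.isCompact_closedBall _ _).uniformContinuousOn_of_continuous hGc).comp
      (CZero.coordL n).uniformContinuous.uniformContinuousOn hmaps) 1
    fun x hx => hG1 _ (hmaps hx)
  refine ⟨f, Au.norm_le_of_forall fun x => hG1 _ (hmaps x.2), fun z => ?_⟩
  refine pointEval_eq_of_tendsto (f := f) ?_
  have hz : z.1 n ∈ closedBall (0 : ℂ) 1 := mem_closedBall_zero_iff.2 (z.norm_apply_le n)
  refine (hGc (z.1 n) hz).tendsto.comp (tendsto_nhdsWithin_iff.2 ⟨tendsto_coord_approxPt z n, ?_⟩)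
  exact Eventually.of_forall fun k => hmaps (approxPt z k).2

/-- With `b = w n`, the function `q = 1 - b̄t` has nonnegative real part on the closed disc and
vanishes at `b`. Hence `q / (q + ε)` is an admissible test function vanishing at `w`, and its
modulus at `z` tends to 1 as `ε` decreases to 0. -/
theorem one_le_pseudoHyp_of_norm_eq_one {z w : ClosedBallLInf} {n : ℕ} (hw : ‖w.1 n‖ = 1)
    (hzw : z.1 n ≠ w.1 n) : 1 ≤ pseudoHyp (pointEval z) (pointEval w) := by
  set a := z.1 n with ha
  set b := w.1 n with hb
  have hab : 1 - star b * a ≠ 0 := fun h =>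
    hzw (eq_of_star_mul_eq_one (z.norm_apply_le n) (w.norm_apply_le n) h)
  have hbb : star b * b = 1 := by
    rw [Complex.star_def, Complex.conj_mul', hw]
    simp
  have hre : ∀ t ∈ closedBall (0 : ℂ) 1, 0 ≤ (1 - star b * t).re := by
    intro t ht
    rw [mem_closedBall_zero_iff] at ht
    have h1 := Complex.re_le_norm (star b * t)
    rw [norm_mul, norm_star, hw, one_mul] at h1
    rw [Complex.sub_re, Complex.one_re]
    linarith
  have key : ∀ ε : ℝ, 0 < ε →
      ‖(1 - star b * a) / (1 - star b * a + ε)‖ ≤ pseudoHyp (pointEval z) (pointEval w) := by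
    intro ε hε
    have hne : ∀ t ∈ closedBall (0 : ℂ) 1, 1 - star b * t + ε ≠ 0 := by
      intro t ht h0
      have h1 := congrArg Complex.re h0
      rw [Complex.add_re, Complex.ofReal_re, Complex.zero_re] at h1
      linarith [hre t ht]
    obtain ⟨f, hf, hfz⟩ := exists_au_of_coord (U := {t | 1 - star b * t + ε ≠ 0})
      (isOpen_ne_fun (by fun_prop) continuous_const) hne
      (G := fun t => (1 - star b * t) / (1 - star b * t + ε))
      (DifferentiableOn.fun_div (by fun_prop) (by fun_prop) fun t ht => ht) (by
        intro t ht
        rw [norm_div]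
        refine div_le_one_of_le₀ ?_ (norm_nonneg _)
        refine le_of_sq_le_sq ?_ (norm_nonneg _)
        simp only [Complex.sq_norm, Complex.normSq_apply, Complex.add_re, Complex.add_im,
          Complex.ofReal_re, Complex.ofReal_im]
        nlinarith [hre t ht]) n
    have := norm_le_pseudoHyp (pointEval z) (pointEval w) hf (by rw [hfz, ← hb, hbb]; simp)
    rwa [hfz] at this
  have hlim : Tendsto (fun ε : ℝ => ‖(1 - star b * a) / (1 - star b * a + ε)‖) (𝓝[>] 0) (𝓝 1) := by
    have h1 : ContinuousAt (fun ε : ℝ => ‖(1 - star b * a) / (1 - star b * a + ε)‖) 0 := by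
      refine ContinuousAt.norm (ContinuousAt.div (by fun_prop) (by fun_prop) ?_)
      simpa using hab
    have h2 := h1.tendsto
    rw [Complex.ofReal_zero, add_zero, div_self hab, norm_one] at h2
    exact h2.mono_left nhdsWithin_le_nhds
  exact le_of_tendsto hlim (eventually_nhdsWithin_of_forall fun ε hε => key ε hε)

/-- The Schwarz–Pick inequality for the coordinates of two points in the same Gleason part. -/
theorem schwarzPick_of_pseudoHyp_lt_one {z w : ClosedBallLInf}
    (h : pseudoHyp (pointEval z) (pointEval w) < 1) (n : ℕ) :
    (1 - pseudoHyp (pointEval z) (pointEval w) ^ 2) * ‖1 - star (w.1 n) * z.1 n‖ ^ 2 ≤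
      (1 - ‖z.1 n‖ ^ 2) * (1 - ‖w.1 n‖ ^ 2) := by
  set ρ := pseudoHyp (pointEval z) (pointEval w) with hρ
  -- If `|w n| < 1`, the test function is the Möbius map of the `n`-th coordinate. If `|w n| = 1`
  -- that map degenerates, but the peaking functions force `z n = w n`.
  rcases (w.norm_apply_le n).lt_or_eq with hw | hw
  · have hne : ∀ t ∈ closedBall (0 : ℂ) 1, 1 - star (w.1 n) * t ≠ 0 := fun t ht =>
      one_sub_star_mul_ne_zero (mem_closedBall_zero_iff.1 ht) hw
    obtain ⟨f, hf, hfz⟩ := exists_au_of_coord (U := {t | 1 - star (w.1 n) * t ≠ 0})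
      (isOpen_ne_fun (by fun_prop) continuous_const) hne
      (G := fun t => (t - w.1 n) / (1 - star (w.1 n) * t))
      (DifferentiableOn.fun_div (by fun_prop) (by fun_prop) fun t ht => ht) (by
        intro t ht
        rw [norm_div]
        exact div_le_one_of_le₀ (norm_sub_le_norm_one_sub (mem_closedBall_zero_iff.1 ht) hw.le)
          (norm_nonneg _)) n
    have h1 := norm_le_pseudoHyp (pointEval z) (pointEval w) hf (by rw [hfz]; simp)
    have hz : 0 < ‖1 - star (w.1 n) * z.1 n‖ :=
      norm_pos_iff.2 (hne _ (mem_closedBall_zero_iff.2 (z.norm_apply_le n)))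
    rw [hfz, ← hρ, norm_div, div_le_iff₀ hz] at h1
    have h2 := norm_one_sub_conj_mul_sq_sub (z.1 n) (w.1 n)
    have h3 := pow_le_pow_left₀ (norm_nonneg _) h1 2
    nlinarith
  · have hzw : z.1 n = w.1 n := by
      by_contra hne
      exact absurd (one_le_pseudoHyp_of_norm_eq_one hw hne) (not_le.2 h)
    have hbb : star (w.1 n) * w.1 n = 1 := by
      rw [Complex.star_def, Complex.conj_mul', hw]
      simp
    rw [hzw, hbb, hw]
    simp

/-! ### Gleason parts of point evaluations -/

theorem pointEval_mem_gleasonPart {z w : ClosedBallLInf} {r : ℝ} (hr : r < 1)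
    (h : ∀ n, w.1 n = z.1 n ∨ (‖z.1 n‖ ≤ r ∧ ‖w.1 n‖ ≤ r)) :
    pointEval w ∈ gleasonPart (pointEval z) := by
  set s := max r 0 with hs
  have hs0 : 0 ≤ s := le_max_right _ _
  have hs1 : s < 1 := max_lt hr one_pos
  have hss : 0 < 1 - s ^ 2 := by nlinarith
  -- Chosen so that `4 (1 - ρ²) = (1 - s²)²`: here 4 bounds `|1 - w̄z|²`, and `(1 - s²)²` bounds the
  -- right-hand side from below at the coordinates that may differ.
  set ρ := Real.sqrt (1 - (1 - s ^ 2) ^ 2 / 4) with hρ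
  have hρ2 : ρ ^ 2 = 1 - (1 - s ^ 2) ^ 2 / 4 := Real.sq_sqrt (by nlinarith)
  have hρ0 : 0 < ρ := Real.sqrt_pos.2 (by nlinarith)
  have hρ1 : ρ < 1 := by nlinarith [pow_pos hss 2]
  refine lt_of_le_of_lt (pseudoHyp_pointEval_le hρ0 hρ1 fun n => ?_) hρ1
  rw [hρ2, sub_sub_cancel]
  rcases h n with h | ⟨h1, h2⟩
  · have h3 := norm_one_sub_conj_mul_sq_sub (z.1 n) (z.1 n)
    rw [sub_self, norm_zero] at h3
    rw [h]
    nlinarith [sq_nonneg ‖1 - star (z.1 n) * z.1 n‖]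
  · have h4 : ‖1 - star (w.1 n) * z.1 n‖ ≤ 2 := by
      refine (norm_sub_le _ _).trans ?_
      rw [norm_one, norm_mul, norm_star]
      have := mul_le_one₀ (w.norm_apply_le n) (norm_nonneg _) (z.norm_apply_le n)
      linarith
    have h5 : ‖z.1 n‖ ^ 2 ≤ s ^ 2 :=
      pow_le_pow_left₀ (norm_nonneg _) (h1.trans (le_max_left _ _)) 2
    have h6 : ‖w.1 n‖ ^ 2 ≤ s ^ 2 :=
      pow_le_pow_left₀ (norm_nonneg _) (h2.trans (le_max_left _ _)) 2
    have h7 : ‖1 - star (w.1 n) * z.1 n‖ ^ 2 ≤ 4 := by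
      nlinarith [norm_nonneg (1 - star (w.1 n) * z.1 n)]
    have h8 : (1 - s ^ 2) * (1 - s ^ 2) ≤ (1 - ‖z.1 n‖ ^ 2) * (1 - ‖w.1 n‖ ^ 2) := by
      gcongr
      linarith
    nlinarith [pow_pos hss 2]

/-- The Gleason part of `δ_z` when the coordinates that are not unimodular stay away from the
circle. -/
theorem gleasonPart_pointEval {z : ClosedBallLInf} {N : Set ℕ} (hN : N = (unimodularIdx z)ᶜ)
    {r : ℝ} (hr : r < 1) (hz : ∀ n ∈ N, ‖z.1 n‖ ≤ r) :
    gleasonPart (pointEval z) = {φ | ∃ w : ClosedBallLInf, φ = pointEval w ∧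
      (∀ n ∈ unimodularIdx z, w.1 n = z.1 n) ∧ ∃ r : ℝ, r < 1 ∧ ∀ n ∈ N, ‖w.1 n‖ ≤ r} := by
  ext φ
  constructor
  · intro hφ
    obtain ⟨w, rfl⟩ := exists_eq_pointEval φ
    have hlt : pseudoHyp (pointEval z) (pointEval w) < 1 := hφ
    have hSP := schwarzPick_of_pseudoHyp_lt_one hlt
    set ρ := pseudoHyp (pointEval z) (pointEval w) with hρ
    have hρ0 : 0 ≤ ρ := pseudoHyp_nonneg _ _
    have hρρ : 0 < 1 - ρ ^ 2 := by nlinarith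
    -- The radius comes from `(1 - ρ²)(1 - r)² ≤ 1 - |w n|²`, which follows from Schwarz–Pick and
    -- `|1 - w̄z| ≥ 1 - r`.
    refine ⟨w, rfl, fun n hn => ?_, Real.sqrt (1 - (1 - ρ ^ 2) * (1 - r) ^ 2), ?_, fun n hn => ?_⟩
    · have hn1 : ‖z.1 n‖ = 1 := hn
      have h1 := hSP n
      rw [hn1] at h1
      have h2 : ‖1 - star (w.1 n) * z.1 n‖ ^ 2 ≤ 0 := by nlinarith
      have h3 : ‖1 - star (w.1 n) * z.1 n‖ = 0 :=
        pow_eq_zero_iff two_ne_zero |>.1 (le_antisymm h2 (sq_nonneg _))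
      exact (eq_of_star_mul_eq_one (z.norm_apply_le n) (w.norm_apply_le n)
        (norm_eq_zero.1 h3)).symm
    · rw [Real.sqrt_lt' one_pos]
      have : 0 < (1 - ρ ^ 2) * (1 - r) ^ 2 := mul_pos hρρ (pow_pos (by linarith) 2)
      linarith
    · refine Real.le_sqrt_of_sq_le ?_
      have h1 := hSP n
      have h2 : 1 - r ≤ ‖1 - star (w.1 n) * z.1 n‖ := by
        have h3 := norm_sub_norm_le 1 (star (w.1 n) * z.1 n)
        rw [norm_one, norm_mul, norm_star] at h3
        have h4 := mul_le_of_le_one_left (norm_nonneg (z.1 n)) (w.norm_apply_le n)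
        have := hz n hn
        linarith
      have h5 : (1 - r) ^ 2 ≤ ‖1 - star (w.1 n) * z.1 n‖ ^ 2 :=
        pow_le_pow_left₀ (by linarith) h2 2
      have h6 : (1 - ‖z.1 n‖ ^ 2) * (1 - ‖w.1 n‖ ^ 2) ≤ 1 - ‖w.1 n‖ ^ 2 := by
        refine mul_le_of_le_one_left ?_ (by nlinarith [sq_nonneg ‖z.1 n‖])
        rw [sub_nonneg]
        exact pow_le_one₀ (norm_nonneg _) (w.norm_apply_le n)
      have h7 := mul_le_mul_of_nonneg_left h5 hρρ.le
      linarith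
  · rintro ⟨w, rfl, hw1, r', hr', hw2⟩
    refine pointEval_mem_gleasonPart (r := max r r') (max_lt hr hr') fun n => ?_
    by_cases hn : n ∈ unimodularIdx z
    · exact Or.inl (hw1 n hn)
    · have hn' : n ∈ N := hN ▸ hn
      exact Or.inr ⟨(hz n hn').trans (le_max_left _ _), (hw2 n hn').trans (le_max_right _ _)⟩

/-! ### Isometric embeddings of balls into Gleason parts -/

section Isometry

/-- A polynomial in the coordinates composed with `Φ` is represented in `B` by an element of no
larger norm, since norms in `B` are computed on the `χ u`. Density extends the estimate to every
`f`. Leaving `B` and `I` abstract covers the polydisc and the ball of `ℓ_∞` together. -/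
theorem gleasonDist_pointEval_le {B : Type*} [NormedRing B] [NormedAlgebra ℂ B] {I : Type*}
    {χ : I → characterSpace ℂ B} {Φ : I → ClosedBallLInf}
    (hnorm : ∀ (g : B) (C : ℝ), (∀ u, ‖χ u g‖ ≤ C) → ‖g‖ ≤ C)
    (hcoord : ∀ n, ∃ g : B, ∀ u, χ u g = (Φ u).1 n) (u v : I) :
    gleasonDist (pointEval (Φ u)) (pointEval (Φ v)) ≤ gleasonDist (χ u) (χ v) := by
  set D := gleasonDist (χ u) (χ v) with hD
  have hD0 : 0 ≤ D := norm_nonneg _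
  have hpoly : ∀ q ∈ coordPoly CZero.coordL, ∃ g : B, ∀ u, χ u g = pointEval (Φ u) q := by
    intro q hq
    induction hq using Algebra.adjoin_induction with
    | mem x hx =>
      obtain ⟨n, rfl⟩ := hx
      simpa only [pointEval_coord] using hcoord n
    | algebraMap c =>
      exact ⟨algebraMap ℂ B c, fun u => (AlgHomClass.commutes (χ u) c).trans
        (AlgHomClass.commutes (pointEval (Φ u)) c).symm⟩
    | add x y _ _ hx hy =>
      obtain ⟨g, hg⟩ := hx
      obtain ⟨g', hg'⟩ := hy
      exact ⟨g + g', fun u => by rw [map_add, map_add, hg, hg']⟩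
    | mul x y _ _ hx hy =>
      obtain ⟨g, hg⟩ := hx
      obtain ⟨g', hg'⟩ := hy
      exact ⟨g * g', fun u => by rw [map_mul, map_mul, hg, hg']⟩
  refine gleasonDist_le_of_forall hD0 fun f => ?_
  refine le_of_forall_pos_le_add fun η hη => ?_
  -- Two approximation errors `ε` and one error `D * ε` add up to `η`.
  set ε := η / (2 + D) with hε
  have hε0 : 0 < ε := by positivity
  obtain ⟨q, hq, hfq⟩ := exists_coordPoly_norm_sub_le isCZeroBasis_unitVec f hε0
  obtain ⟨g, hg⟩ := hpoly q hq
  have hgq : ‖g‖ ≤ ‖q‖ := hnorm g _ fun u => by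
    rw [hg]; exact character_norm_apply_le _ _
  have hqf : ‖q‖ ≤ ‖f‖ + ε := by
    have := norm_sub_norm_le q f
    rw [norm_sub_rev] at this
    linarith
  have happ : ∀ φ : SpecC0, ‖φ f - φ q‖ ≤ ε := fun φ => by
    rw [← map_sub]; exact (character_norm_apply_le φ _).trans hfq
  have h1 := norm_sub_le_gleasonDist_mul (χ u) (χ v) g
  rw [hg, hg, ← hD] at h1
  have e1 : pointEval (Φ u) f - pointEval (Φ v) f =
      (pointEval (Φ u) f - pointEval (Φ u) q) + (pointEval (Φ u) q - pointEval (Φ v) q) -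
      (pointEval (Φ v) f - pointEval (Φ v) q) := by ring
  rw [e1]
  have h2 := happ (pointEval (Φ u))
  have h3 := happ (pointEval (Φ v))
  have h4 : D * ‖g‖ ≤ D * (‖f‖ + ε) := mul_le_mul_of_nonneg_left (hgq.trans hqf) hD0
  have h5 : (2 + D) * ε = η := by rw [hε]; field_simp
  refine (norm_sub_le _ _).trans (le_trans (add_le_add (norm_add_le _ _) le_rfl) ?_)
  linarith

theorem gleasonDist_le_of_lift {A B : Type*} [NormedRing A] [NormedAlgebra ℂ A] [NormedRing B]
    [NormedAlgebra ℂ B] {χ χ' : characterSpace ℂ B} {φ φ' : characterSpace ℂ A}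
    (h : ∀ g : B, ∃ f : A, ‖f‖ ≤ ‖g‖ ∧ φ f = χ g ∧ φ' f = χ' g) :
    gleasonDist χ χ' ≤ gleasonDist φ φ' := by
  refine gleasonDist_le_of_forall (norm_nonneg _) fun g => ?_
  obtain ⟨f, hf, h1, h2⟩ := h g
  rw [← h1, ← h2]
  refine (norm_sub_le_gleasonDist_mul φ φ' f).trans ?_
  exact mul_le_mul_of_nonneg_left hf (norm_nonneg _)

/-- The restriction of a finite set of coordinates. -/
def CZero.restrictFin {k : ℕ} (e : Fin k → ℕ) : CZero →L[ℂ] (Fin k → ℂ) :=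
  ContinuousLinearMap.pi fun i => CZero.coordL (e i)

theorem CZero.norm_restrictFin_le {k : ℕ} (e : Fin k → ℕ) (x : CZero) :
    ‖CZero.restrictFin e x‖ ≤ ‖x‖ :=
  (pi_norm_le_iff_of_nonneg (norm_nonneg _)).2 fun i => isCZeroBasis_unitVec.norm_coord_le (e i) x

/-- The point `u` lies in the open polydisc, where `g` is continuous, so convergence of finitely
many coordinates suffices. -/
theorem pointEval_compCLM_restrictFin {k : ℕ} (e : Fin k → ℕ) (g : Au (Fin k → ℂ)) (u : Polydisc k)
    {w : ClosedBallLInf} (hw : ∀ i, w.1 (e i) = u.1 i) :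
    pointEval w (Au.compCLM (CZero.restrictFin e) (CZero.norm_restrictFin_le e) g) =
      evalChar (Fin k → ℂ) u g := by
  refine pointEval_eq_of_tendsto ?_
  have h1 : Tendsto (fun n => CZero.restrictFin e (approxPt w n : CZero)) atTop (𝓝 u.1) := by
    rw [tendsto_pi_nhds]
    intro i
    rw [← hw i]
    exact tendsto_coord_approxPt w (e i)
  have h2 : ContinuousAt (zeroExt g.1) u.1 := ((Au.analytic g) u.1 u.2).continuousAt
  have h3 : evalChar (Fin k → ℂ) u g = zeroExt g.1 u.1 := (zeroExt_eq _ u.2).symm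
  rw [h3]
  exact h2.tendsto.comp h1

theorem gleasonDist_pointEval_eq_evalChar {k : ℕ} {e : Fin k → ℕ} (he : Function.Injective e)
    {z : ClosedBallLInf} {F : Polydisc k → ClosedBallLInf}
    (hF : ∀ u, ⇑(F u).1 = Function.extend e u.1 (⇑z.1)) (u v : Polydisc k) :
    gleasonDist (pointEval (F u)) (pointEval (F v)) =
      gleasonDist (evalChar (Fin k → ℂ) u) (evalChar (Fin k → ℂ) v) := by
  have hFe : ∀ u i, (F u).1 (e i) = u.1 i := fun u i => by rw [hF, he.extend_apply]
  refine le_antisymm (gleasonDist_pointEval_le (fun g C h => Au.norm_le_of_forall h) ?_ u v) ?_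
  · intro n
    by_cases hn : ∃ i, e i = n
    · obtain ⟨i, rfl⟩ := hn
      exact ⟨Au.ofDual (ContinuousLinearMap.proj i), fun u => (hFe u i).symm⟩
    · refine ⟨algebraMap ℂ _ (z.1 n), fun u => ?_⟩
      rw [hF, Function.extend_apply' _ _ _ hn]
      exact AlgHomClass.commutes (evalChar (Fin k → ℂ) u) (z.1 n)
  · exact gleasonDist_le_of_lift fun g => ⟨_, Au.norm_compCLM_le _ (CZero.norm_restrictFin_le e) g,
      pointEval_compCLM_restrictFin e g u (hFe u), pointEval_compCLM_restrictFin e g v (hFe v)⟩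

/-- The restriction of an infinite set of coordinates. -/
def CZero.restrictSeq (e : ℕ → ℕ) (he : Function.Injective e) : CZero →L[ℂ] CZero :=
  LinearMap.mkContinuous
    { toFun := fun x : CZero =>
        { toFun := fun n => x (e n)
          continuous_toFun := continuous_of_discreteTopology
          zero_at_infty' := by
            have h := x.zero_at_infty'
            rw [Filter.cocompact_eq_cofinite] at h ⊢
            exact h.comp he.tendsto_cofinite }
      map_add' := fun _ _ => rfl
      map_smul' := fun _ _ => rfl } 1 fun x => by
    rw [one_mul]
    exact isCZeroBasis_unitVec.norm_le _ _ (norm_nonneg _) fun i =>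
      isCZeroBasis_unitVec.norm_coord_le (e i) x

theorem CZero.norm_restrictSeq_le (e : ℕ → ℕ) (he : Function.Injective e) (x : CZero) :
    ‖CZero.restrictSeq e he x‖ ≤ ‖x‖ :=
  isCZeroBasis_unitVec.norm_le _ _ (norm_nonneg _) fun i =>
    isCZeroBasis_unitVec.norm_coord_le (e i) x

/-- A composition operator pulls characters back to characters. -/
theorem exists_character_comp {X Y : Type*} [NormedAddCommGroup X] [NormedSpace ℂ X]
    [NormedAddCommGroup Y] [NormedSpace ℂ Y] (R : X →L[ℂ] Y) (hR : ∀ x, ‖R x‖ ≤ ‖x‖)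
    (φ : characterSpace ℂ (Au X)) :
    ∃ ψ : characterSpace ℂ (Au Y), ∀ g, ψ g = φ (Au.compCLM R hR g) := by
  have hx : ∀ x : ball (0 : X) 1, R x ∈ ball (0 : Y) 1 := fun x => by
    rw [mem_ball_zero_iff]
    exact (hR x).trans_lt (mem_ball_zero_iff.1 x.2)
  let Λ : StrongDual ℂ (Au Y) := LinearMap.mkContinuous
    { toFun := fun g => φ (Au.compCLM R hR g)
      map_add' := fun f g => by
        rw [← map_add]
        congr 1
        refine Au.ext fun x => ?_
        change _ = (Au.compCLM R hR f).1 x + (Au.compCLM R hR g).1 x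
        rw [Au.compCLM_apply R hR _ x (hx x), Au.compCLM_apply R hR _ x (hx x),
          Au.compCLM_apply R hR _ x (hx x)]
        rfl
      map_smul' := fun c g => by
        rw [RingHom.id_apply, ← map_smul]
        congr 1
        refine Au.ext fun x => ?_
        change _ = c * (Au.compCLM R hR g).1 x
        rw [Au.compCLM_apply R hR _ x (hx x), Au.compCLM_apply R hR _ x (hx x)]
        rfl } 1
    fun g => by
      rw [one_mul]
      exact (character_norm_apply_le φ _).trans (Au.norm_compCLM_le R hR g)
  refine ⟨⟨StrongDual.toWeakDual Λ, ?_, ?_⟩, fun g => rfl⟩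
  · intro h
    have h1 : φ (Au.compCLM R hR 1) = 0 := DFunLike.congr_fun h (1 : Au Y)
    have h2 : Au.compCLM R hR 1 = 1 := Au.ext fun x => Au.compCLM_apply R hR _ x (hx x)
    rw [h2, map_one] at h1
    exact one_ne_zero h1
  · intro f g
    change φ (Au.compCLM R hR (f * g)) = φ (Au.compCLM R hR f) * φ (Au.compCLM R hR g)
    rw [← map_mul]
    congr 1
    refine Au.ext fun x => ?_
    change _ = (Au.compCLM R hR f).1 x * (Au.compCLM R hR g).1 x
    rw [Au.compCLM_apply R hR _ x (hx x), Au.compCLM_apply R hR _ x (hx x),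
      Au.compCLM_apply R hR _ x (hx x)]
    rfl

/-- Both sides are characters in `g`, so comparison on the coordinates is enough; the limit in `ℓ_∞`
is only coordinatewise and would not allow a continuity argument. -/
theorem pointEval_compCLM_restrictSeq {e : ℕ → ℕ} (he : Function.Injective e) (g : Au CZero)
    {u w : ClosedBallLInf} (hw : ∀ i, w.1 (e i) = u.1 i) :
    pointEval w (Au.compCLM (CZero.restrictSeq e he) (CZero.norm_restrictSeq_le e he) g) =
      pointEval u g := by
  obtain ⟨ψ, hψ⟩ := exists_character_comp (CZero.restrictSeq e he) (CZero.norm_restrictSeq_le e he)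
    (pointEval w)
  have : ψ = pointEval u := by
    refine character_ext isCZeroBasis_unitVec fun n => ?_
    rw [hψ, pointEval_coord, ← hw n, ← pointEval_coord w (e n)]
    congr 1
    refine Au.ext fun x => ?_
    refine Au.compCLM_apply _ _ _ x ?_
    rw [mem_ball_zero_iff]
    exact (CZero.norm_restrictSeq_le e he x).trans_lt (mem_ball_zero_iff.1 x.2)
  rw [← hψ, this]

/-- Evaluations at points of the open ball of `c₀` are among these characters. -/
theorem norm_le_of_forall_pointEval {g : Au CZero} {C : ℝ}
    (h : ∀ u : OpenBallLInf, ‖pointEval u.toClosed g‖ ≤ C) : ‖g‖ ≤ C := by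
  refine Au.norm_le_of_forall fun x => ?_
  obtain ⟨z, hz⟩ := exists_eq_pointEval (evalChar CZero x)
  have hzn : ∀ n, z.1 n = CZero.coordL n x := fun n => by
    rw [← pointEval_coord, ← hz]
    rfl
  have hz1 : z.1 ∈ ball (0 : LInf) 1 := by
    rw [mem_ball_zero_iff]
    refine lt_of_le_of_lt (lp.norm_le_of_forall_le (norm_nonneg (x : CZero)) fun n => ?_)
      (mem_ball_zero_iff.1 x.2)
    rw [hzn]
    exact isCZeroBasis_unitVec.norm_coord_le n x
  have h1 := h ⟨z.1, hz1⟩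
  have h2 : OpenBallLInf.toClosed ⟨z.1, hz1⟩ = z := rfl
  rw [h2, ← hz] at h1
  exact h1

theorem gleasonDist_pointEval_eq {e : ℕ → ℕ} (he : Function.Injective e)
    {z : ClosedBallLInf} {F : OpenBallLInf → ClosedBallLInf}
    (hF : ∀ u, ⇑(F u).1 = Function.extend e (⇑u.1) (⇑z.1)) (u v : OpenBallLInf) :
    gleasonDist (pointEval (F u)) (pointEval (F v)) =
      gleasonDist (pointEval u.toClosed) (pointEval v.toClosed) := by
  have hFe : ∀ u i, (F u).1 (e i) = u.1 i := fun u i => by rw [hF, he.extend_apply]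
  refine le_antisymm (gleasonDist_pointEval_le (χ := fun u : OpenBallLInf => pointEval u.toClosed)
    (fun g C h => norm_le_of_forall_pointEval h) ?_ u v) ?_
  · intro n
    by_cases hn : ∃ i, e i = n
    · obtain ⟨i, rfl⟩ := hn
      exact ⟨Au.ofDual (CZero.coordL i), fun u => by
        rw [pointEval_coord, hFe]; rfl⟩
    · refine ⟨algebraMap ℂ _ (z.1 n), fun u => ?_⟩
      rw [hF, Function.extend_apply' _ _ _ hn]
      exact AlgHomClass.commutes (pointEval u.toClosed) (z.1 n)
  · exact gleasonDist_le_of_lift fun g =>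
      ⟨_, Au.norm_compCLM_le _ (CZero.norm_restrictSeq_le e he) g,
        pointEval_compCLM_restrictSeq he g (hFe u), pointEval_compCLM_restrictSeq he g (hFe v)⟩

end Isometry

/-! ### Replacing coordinates -/

section Replace

variable {ι : Type*} {e : ι → ℕ}

theorem norm_extend_le_one {v : ι → ℂ} (hv : ∀ i, ‖v i‖ ≤ 1) (he : Function.Injective e)
    (z : ClosedBallLInf) (n : ℕ) : ‖Function.extend e v (⇑z.1) n‖ ≤ 1 := by
  by_cases hn : ∃ i, e i = n
  · obtain ⟨i, rfl⟩ := hn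
    rw [he.extend_apply]
    exact hv i
  · rw [Function.extend_apply' _ _ _ hn]
    exact z.norm_apply_le n

/-- The point obtained from `z` by replacing the coordinates in the range of `e`. -/
def replaceCoord (he : Function.Injective e) (z : ClosedBallLInf) (v : ι → ℂ)
    (hv : ∀ i, ‖v i‖ ≤ 1) : ClosedBallLInf :=
  ClosedBallLInf.mk (Function.extend e v (⇑z.1)) (norm_extend_le_one hv he z)

theorem coe_replaceCoord (he : Function.Injective e) (z : ClosedBallLInf) (v : ι → ℂ)
    (hv : ∀ i, ‖v i‖ ≤ 1) : ⇑(replaceCoord he z v hv).1 = Function.extend e v (⇑z.1) := rfl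

variable {U : Type*} {val : U → ι → ℂ} {z : ClosedBallLInf} {F : U → ClosedBallLInf}

theorem injective_pointEval_extend (he : Function.Injective e) (hval : Function.Injective val)
    (hF : ∀ u, ⇑(F u).1 = Function.extend e (val u) (⇑z.1)) :
    Function.Injective fun u => pointEval (F u) := by
  intro u v huv
  have h := pointEval_injective huv
  refine hval (funext fun i => ?_)
  rw [← he.extend_apply (val u) (⇑z.1) i, ← he.extend_apply (val v) (⇑z.1) i, ← hF, ← hF, h]

theorem range_pointEval_extend_subset (he : Function.Injective e)
    (hval : ∀ u, ∃ r : ℝ, r < 1 ∧ ∀ i, ‖val u i‖ ≤ r)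
    (hF : ∀ u, ⇑(F u).1 = Function.extend e (val u) (⇑z.1)) {r : ℝ} (hr : r < 1)
    (hz : ∀ i, ‖z.1 (e i)‖ ≤ r) :
    range (fun u => pointEval (F u)) ⊆ gleasonPart (pointEval z) := by
  rintro _ ⟨u, rfl⟩
  obtain ⟨s, hs, hus⟩ := hval u
  refine pointEval_mem_gleasonPart (r := max r s) (max_lt hr hs) fun n => ?_
  rw [hF]
  by_cases hn : ∃ i, e i = n
  · obtain ⟨i, rfl⟩ := hn
    rw [he.extend_apply]
    exact Or.inr ⟨(hz i).trans (le_max_left _ _), (hus i).trans (le_max_right _ _)⟩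
  · exact Or.inl (Function.extend_apply' _ _ _ hn)

/-- Together `hval` and `hsurj` say that `U` consists of the families bounded by some constant below
1, which is the freedom that `gleasonPart_pointEval` leaves in the coordinates of `N`. -/
theorem range_pointEval_extend (he : Function.Injective e)
    (hval : ∀ u, ∃ r : ℝ, r < 1 ∧ ∀ i, ‖val u i‖ ≤ r)
    (hsurj : ∀ (v : ι → ℂ) (r : ℝ), r < 1 → (∀ i, ‖v i‖ ≤ r) → ∃ u, val u = v)
    (hF : ∀ u, ⇑(F u).1 = Function.extend e (val u) (⇑z.1)) {N : Set ℕ}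
    (hN : N = (unimodularIdx z)ᶜ) (heN : range e = N) {r : ℝ} (hr : r < 1)
    (hz : ∀ n ∈ N, ‖z.1 n‖ ≤ r) :
    range (fun u => pointEval (F u)) = gleasonPart (pointEval z) := by
  refine Subset.antisymm (range_pointEval_extend_subset he hval hF hr fun i =>
    hz _ (heN ▸ mem_range_self i)) ?_
  rw [gleasonPart_pointEval hN hr hz]
  rintro _ ⟨w, rfl, hw1, s, hs, hw2⟩
  obtain ⟨u, hu⟩ := hsurj (fun i => w.1 (e i)) s hs fun i => hw2 _ (heN ▸ mem_range_self i)
  refine ⟨u, congrArg pointEval (ClosedBallLInf.ext fun n => ?_)⟩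
  rw [hF]
  by_cases hn : ∃ i, e i = n
  · obtain ⟨i, rfl⟩ := hn
    rw [he.extend_apply, hu]
  · rw [Function.extend_apply' _ _ _ hn]
    refine (hw1 n ?_).symm
    by_contra h
    have : n ∈ range e := by rw [heN, hN]; exact h
    exact hn this

end Replace

/-! ### Points of the open balls as bounded families, and enumerations of index sets -/

theorem Polydisc.norm_apply_le {k : ℕ} (u : Polydisc k) :
    ∃ r : ℝ, r < 1 ∧ ∀ i, ‖u.1 i‖ ≤ r :=
  ⟨‖u.1‖, mem_ball_zero_iff.1 u.2, norm_le_pi_norm u.1⟩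

theorem Polydisc.exists_of_norm_le {k : ℕ} (v : Fin k → ℂ) (r : ℝ) (hr : r < 1)
    (hv : ∀ i, ‖v i‖ ≤ r) : ∃ u : Polydisc k, u.1 = v :=
  ⟨⟨v, mem_ball_zero_iff.2 ((pi_norm_lt_iff one_pos).2 fun i => (hv i).trans_lt hr)⟩, rfl⟩

theorem OpenBallLInf.norm_apply_le (u : OpenBallLInf) :
    ∃ r : ℝ, r < 1 ∧ ∀ i, ‖u.1 i‖ ≤ r :=
  ⟨‖u.1‖, mem_ball_zero_iff.1 u.2, LInf.norm_apply_le u.1⟩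

theorem OpenBallLInf.exists_of_norm_le (v : ℕ → ℂ) (r : ℝ) (hr : r < 1)
    (hv : ∀ i, ‖v i‖ ≤ r) : ∃ u : OpenBallLInf, ⇑u.1 = v := by
  refine ⟨⟨⟨v, memℓp_infty ⟨r, by rintro _ ⟨n, rfl⟩; exact hv n⟩⟩, ?_⟩, rfl⟩
  rw [mem_ball_zero_iff]
  exact (lp.norm_le_of_forall_le ((norm_nonneg _).trans (hv 0)) hv).trans_lt hr

theorem OpenBallLInf.coe_injective : Function.Injective fun u : OpenBallLInf => (⇑u.1 : ℕ → ℂ) :=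
  fun _ _ h => Subtype.ext (lp.ext h)

theorem exists_polydisc_embedding {k : ℕ} {e : Fin k → ℕ} (he : Function.Injective e)
    (z : ClosedBallLInf) : ∃ F : Polydisc k → ClosedBallLInf,
      ∀ u, ⇑(F u).1 = Function.extend e u.1 (⇑z.1) :=
  ⟨fun u => replaceCoord he z u.1 fun i =>
    (norm_le_pi_norm u.1 i).trans (mem_ball_zero_iff.1 u.2).le, fun _ => rfl⟩

theorem exists_openBall_embedding {e : ℕ → ℕ} (he : Function.Injective e) (z : ClosedBallLInf) :
    ∃ F : OpenBallLInf → ClosedBallLInf, ∀ u, ⇑(F u).1 = Function.extend e (⇑u.1) (⇑z.1) :=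
  ⟨fun u => replaceCoord he z (⇑u.1) fun i =>
    (LInf.norm_apply_le u.1 i).trans (mem_ball_zero_iff.1 u.2).le, fun _ => rfl⟩

theorem Set.Infinite.exists_enumeration {N : Set ℕ} (hN : N.Infinite) :
    ∃ e : ℕ → ℕ, Function.Injective e ∧ range e = N := by
  classical
  have := hN.to_subtype
  exact ⟨Nat.orderEmbeddingOfSet N, (Nat.orderEmbeddingOfSet N).injective,
    Nat.orderEmbeddingOfSet_range N⟩

theorem Set.exists_enumeration_of_encard_eq {N : Set ℕ} {k : ℕ} (hN : N.encard = k) :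
    ∃ e : Fin k → ℕ, Function.Injective e ∧ range e = N := by
  have hfin := finite_of_encard_eq_coe hN
  have hcard : hfin.toFinset.card = k := by
    rw [hfin.encard_eq_coe_toFinset_card] at hN
    exact_mod_cast hN
  exact ⟨hfin.toFinset.orderEmbOfFin hcard, (hfin.toFinset.orderEmbOfFin hcard).injective, by simp⟩

theorem exists_lt_one_forall_le {ι : Type*} [Finite ι] {f : ι → ℝ} (hf : ∀ i, f i < 1) :
    ∃ r : ℝ, r < 1 ∧ ∀ i, f i ≤ r := by
  cases isEmpty_or_nonempty ι
  · exact ⟨0, one_pos, fun i => isEmptyElim i⟩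
  · obtain ⟨i, hi⟩ := Finite.exists_max f
    exact ⟨f i, hf i, hi⟩

/-! ### A Lipschitz embedding of the ball of `ℓ_∞` -/

theorem norm_add_one_sub_norm_mul_le {a s : ℂ} (ha : ‖a‖ ≤ 1) (hs : ‖s‖ ≤ 1) :
    ‖a + ((1 - ‖a‖ : ℝ) : ℂ) * s‖ ≤ 1 := by
  refine (norm_add_le _ _).trans ?_
  rw [norm_mul, Complex.norm_real, Real.norm_of_nonneg (by linarith)]
  nlinarith [norm_nonneg s]

/-- The point obtained from `z` by moving each coordinate `z_{e j}` by
`(1 - |z_{e j}|) u_j / 3`. -/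
def moveCoord {e : ℕ → ℕ} (he : Function.Injective e) (z : ClosedBallLInf) (u : OpenBallLInf) :
    ClosedBallLInf :=
  replaceCoord he z (fun j => z.1 (e j) + ((1 - ‖z.1 (e j)‖ : ℝ) : ℂ) * (u.1 j / 3)) fun j =>
    norm_add_one_sub_norm_mul_le (z.norm_apply_le _) (by
      have h1 := (LInf.norm_apply_le u.1 j).trans (mem_ball_zero_iff.1 u.2).le
      rw [norm_div, Complex.norm_ofNat]
      linarith)

theorem moveCoord_apply {e : ℕ → ℕ} (he : Function.Injective e) (z : ClosedBallLInf)
    (u : OpenBallLInf) (j : ℕ) : (moveCoord he z u).1 (e j) =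
      z.1 (e j) + ((1 - ‖z.1 (e j)‖ : ℝ) : ℂ) * (u.1 j / 3) := by
  rw [moveCoord, coe_replaceCoord, he.extend_apply]

theorem moveCoord_apply' {e : ℕ → ℕ} (he : Function.Injective e) (z : ClosedBallLInf)
    (u : OpenBallLInf) {n : ℕ} (hn : ¬∃ j, e j = n) : (moveCoord he z u).1 n = z.1 n := by
  rw [moveCoord, coe_replaceCoord, Function.extend_apply' _ _ _ hn]

/-- The two points lie on a disc that is affine in `t`, with parameters 0 and `c`. The factors `1 -
|z (e j)|` keep the disc in the closed ball however close the coordinates come to the circle, so the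
Schwarz lemma applies. -/
theorem pseudoHyp_moveCoord_le {e : ℕ → ℕ} (he : Function.Injective e) (z : ClosedBallLInf)
    (u v : OpenBallLInf) : pseudoHyp (pointEval (moveCoord he z v)) (pointEval (moveCoord he z u)) ≤
      ‖v.1 - u.1‖ / 2 := by
  have hu : ‖u.1‖ < 1 := mem_ball_zero_iff.1 u.2
  have hv : ‖v.1‖ < 1 := mem_ball_zero_iff.1 v.2
  set c : ℝ := ‖v.1 - u.1‖ / 2 with hc
  have hc0 : 0 ≤ c := by positivity
  have hc1 : c < 1 := by
    have := norm_sub_le v.1 u.1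
    linarith
  have hcn : ‖(c : ℂ)‖ = c := by rw [Complex.norm_real, Real.norm_of_nonneg hc0]
  have hvu : ∀ j, ‖v.1 j - u.1 j‖ ≤ 2 * c := fun j => by
    have : ‖v.1 j - u.1 j‖ ≤ ‖v.1 - u.1‖ := LInf.norm_apply_le (v.1 - u.1) j
    rw [hc]
    linarith
  -- The factor 3 balances the constants: `|u j / 3| ≤ 1 / 3` and `|κ j| ≤ 2 / 3`. If `c = 0`, then
  -- `u = v` and `κ = 0`.
  let κ : ℕ → ℂ := fun j => (v.1 j - u.1 j) / (3 * c)
  have hκ : ∀ j, ‖κ j‖ ≤ 2 / 3 := fun j => by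
    simp only [κ]
    rw [norm_div, norm_mul, hcn, Complex.norm_ofNat]
    refine div_le_of_le_mul₀ (by positivity) (by norm_num) ?_
    linarith [hvu j]
  have hκc : ∀ j, κ j * c = (v.1 j - u.1 j) / 3 := fun j => by
    rcases hc0.eq_or_lt with h | h
    · have h1 := hvu j
      rw [← h, mul_zero, norm_le_zero_iff] at h1
      rw [h1, ← h]
      simp
    · have h2 : (c : ℂ) ≠ 0 := by exact_mod_cast h.ne'
      simp only [κ]
      field_simp
  have := pseudoHyp_pointEval_le_of_disc (z := moveCoord he z v) (w := moveCoord he z u) (c := c)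
    (h := fun t n => Function.extend e (fun j => z.1 (e j) + ((1 - ‖z.1 (e j)‖ : ℝ) : ℂ) *
      (u.1 j / 3 + κ j * t)) (⇑z.1) n) ?_ ?_ (by rwa [hcn]) ?_ ?_
  · rwa [hcn] at this
  · intro n
    by_cases hn : ∃ j, e j = n
    · obtain ⟨j, rfl⟩ := hn
      simp only [he.extend_apply]
      fun_prop
    · simp only [Function.extend_apply' _ _ _ hn]
      fun_prop
  · intro t ht n
    rw [mem_ball_zero_iff] at ht
    refine norm_extend_le_one (fun j => ?_) he z n
    refine norm_add_one_sub_norm_mul_le (z.norm_apply_le _) ?_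
    refine (norm_add_le _ _).trans ?_
    rw [norm_div, norm_mul, Complex.norm_ofNat]
    have h1 := (LInf.norm_apply_le u.1 j).trans hu.le
    have h2 := mul_le_mul (hκ j) ht.le (norm_nonneg _) (by norm_num)
    linarith
  · intro n
    by_cases hn : ∃ j, e j = n
    · obtain ⟨j, rfl⟩ := hn
      rw [moveCoord_apply, he.extend_apply, hκc]
      ring
    · rw [moveCoord_apply' he z v hn, Function.extend_apply' _ _ _ hn]
  · intro n
    by_cases hn : ∃ j, e j = n
    · obtain ⟨j, rfl⟩ := hn
      rw [moveCoord_apply, he.extend_apply, mul_zero, add_zero]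
    · rw [moveCoord_apply' he z u hn, Function.extend_apply' _ _ _ hn]

theorem moveCoord_zero {e : ℕ → ℕ} (he : Function.Injective e) (z : ClosedBallLInf) :
    moveCoord he z ⟨0, mem_ball_self one_pos⟩ = z := by
  refine ClosedBallLInf.ext fun n => ?_
  by_cases hn : ∃ j, e j = n
  · obtain ⟨j, rfl⟩ := hn
    rw [moveCoord_apply]
    simp
  · rw [moveCoord_apply' he z _ hn]

theorem pointEval_moveCoord_mem_gleasonPart {e : ℕ → ℕ} (he : Function.Injective e)
    (z : ClosedBallLInf) (u : OpenBallLInf) :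
    pointEval (moveCoord he z u) ∈ gleasonPart (pointEval z) := by
  have h := pseudoHyp_moveCoord_le he z u ⟨0, mem_ball_self one_pos⟩
  rw [moveCoord_zero, zero_sub, norm_neg] at h
  have hu : ‖u.1‖ < 1 := mem_ball_zero_iff.1 u.2
  refine lt_of_le_of_lt h ?_
  linarith

theorem moveCoord_injective {e : ℕ → ℕ} (he : Function.Injective e) {z : ClosedBallLInf}
    (hz : ∀ j, ‖z.1 (e j)‖ ≠ 1) : Function.Injective (moveCoord he z) := by
  intro u v huv
  refine OpenBallLInf.coe_injective (funext fun j => ?_)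
  have h : (moveCoord he z u).1 (e j) = (moveCoord he z v).1 (e j) := by rw [huv]
  rw [moveCoord_apply, moveCoord_apply] at h
  have h1 : ((1 - ‖z.1 (e j)‖ : ℝ) : ℂ) ≠ 0 := by
    rw [Ne, Complex.ofReal_eq_zero, sub_eq_zero]
    exact (hz j).symm
  have h2 := mul_left_cancel₀ h1 (add_left_cancel h)
  exact (div_left_inj' (by norm_num)).1 h2

theorem continuous_toDual_moveCoord {e : ℕ → ℕ} (he : Function.Injective e) (z : ClosedBallLInf) :
    Continuous fun u => toDual (pointEval (moveCoord he z u)) := by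
  refine LipschitzWith.continuous (K := 1) (LipschitzWith.of_dist_le_mul fun v u => ?_)
  rw [dist_eq_norm, NNReal.coe_one, one_mul, Subtype.dist_eq, dist_eq_norm]
  have h1 := gleasonDist_le_two_mul_pseudoHyp (pointEval (moveCoord he z v))
    (pointEval (moveCoord he z u))
  have h2 := pseudoHyp_moveCoord_le he z u v
  refine h1.trans ?_
  linarith

/-! ### The classification -/

theorem IsSplitting.eq_compl {z : ClosedBallLInf} {N₂ N₃ : Set ℕ} (h : IsSplitting z N₂ N₃)
    (h₃ : N₃ = ∅) : N₂ = (unimodularIdx z)ᶜ := by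
  rw [← h.union, h₃, union_empty]

/-- All non-unimodular coordinates go into `N₂` if they stay away from the circle and into `N₃`
otherwise. In the second case `N₃` is infinite, because finitely many numbers below 1 have a common
bound below 1. -/
theorem exists_isSplitting (z : ClosedBallLInf) :
    ∃ N₂ N₃ : Set ℕ, IsSplitting z N₂ N₃ ∧
      (N₂ = Set.univ ∨ unimodularIdx z = Set.univ ∨
        (N₃ = ∅ ∧ (unimodularIdx z).Nonempty ∧ N₂.Nonempty) ∨
        (N₃.Infinite ∧ N₂ = ∅) ∨ (N₂.Infinite ∧ N₃.Infinite)) := by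
  by_cases hC : ∃ r : ℝ, r < 1 ∧ ∀ n ∈ (unimodularIdx z)ᶜ, ‖z.1 n‖ ≤ r
  · refine ⟨(unimodularIdx z)ᶜ, ∅, ⟨disjoint_bot_right, union_empty _, hC, fun h =>
      absurd h not_nonempty_empty⟩, ?_⟩
    rcases (unimodularIdx z).eq_empty_or_nonempty with h | h
    · left
      rw [h, compl_empty]
    · by_cases h' : unimodularIdx z = univ
      · exact Or.inr (Or.inl h')
      · exact Or.inr (Or.inr (Or.inl ⟨rfl, h, nonempty_compl.2 h'⟩))
  · refine ⟨∅, (unimodularIdx z)ᶜ, ⟨disjoint_bot_left, empty_union _, ⟨0, one_pos, by simp⟩,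
      fun _ => ⟨?_, ?_⟩⟩, Or.inr (Or.inr (Or.inr (Or.inl ⟨?_, rfl⟩)))⟩
    · rintro _ ⟨n, -, rfl⟩
      exact z.norm_apply_le n
    · intro b hb
      by_contra! hb1
      exact hC ⟨b, hb1, fun n hn => hb ⟨n, hn, rfl⟩⟩
    · intro hfin
      have := hfin.to_subtype
      obtain ⟨r, hr, h⟩ := exists_lt_one_forall_le
        (f := fun n : ((unimodularIdx z)ᶜ : Set ℕ) => ‖z.1 n‖)
        fun n => lt_of_le_of_ne (z.norm_apply_le n) n.2
      exact hC ⟨r, hr, fun n hn => h ⟨n, hn⟩⟩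

theorem gleasonPart_pointEval_of_norm_lt_one {z : ClosedBallLInf} (hz : ‖z.1‖ < 1) :
    gleasonPart (pointEval z) = range fun w : OpenBallLInf => pointEval w.toClosed := by
  have hN : (univ : Set ℕ) = (unimodularIdx z)ᶜ := by
    refine (eq_univ_of_forall fun n => ?_).symm
    exact ((LInf.norm_apply_le z.1 n).trans_lt hz).ne
  refine (range_pointEval_extend (e := id) (val := fun u : OpenBallLInf => ⇑u.1) (z := z)
    Function.injective_id OpenBallLInf.norm_apply_le OpenBallLInf.exists_of_norm_le (fun u => ?_) hN
    range_id hz fun n _ => LInf.norm_apply_le z.1 n).symm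
  funext n
  exact (Function.injective_id.extend_apply (⇑u.1) (⇑z.1) n).symm

theorem mainTheorem2 :
    ∃ δ : ClosedBallLInf → SpecC0, IsPointEvaluation δ ∧
    ∀ z : ClosedBallLInf,
    -- the coordinates can be split so that one of the five cases below occurs
    (∃ N₂ N₃ : Set ℕ, IsSplitting z N₂ N₃ ∧
      (N₂ = Set.univ ∨ unimodularIdx z = Set.univ ∨
        (N₃ = ∅ ∧ (unimodularIdx z).Nonempty ∧ N₂.Nonempty) ∨
        (N₃.Infinite ∧ N₂ = ∅) ∨ (N₂.Infinite ∧ N₃.Infinite))) ∧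
    ∀ N₂ N₃ : Set ℕ, IsSplitting z N₂ N₃ →
    -- (i)
    (N₂ = Set.univ →
      ‖z.1‖ < 1 ∧
      gleasonPart (δ z) = gleasonPart (δ ⟨0, Metric.mem_closedBall_self zero_le_one⟩) ∧
      gleasonPart (δ z) = Set.range (fun w : OpenBallLInf => δ w.toClosed) ∧
      Function.Injective (fun w : OpenBallLInf => δ w.toClosed)) ∧
    -- (ii)
    (unimodularIdx z = Set.univ → (∀ n, ‖z.1 n‖ = 1) ∧ gleasonPart (δ z) = {δ z}) ∧
    -- (iii)
    (N₃ = ∅ → (unimodularIdx z).Nonempty → N₂.Nonempty →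
      gleasonPart (δ z) = {φ | ∃ w : ClosedBallLInf, φ = δ w ∧
        (∀ n ∈ unimodularIdx z, w.1 n = z.1 n) ∧ ∃ r : ℝ, r < 1 ∧ ∀ n ∈ N₂, ‖w.1 n‖ ≤ r} ∧
      (∀ k : ℕ, N₂.encard = k →
        ∃ (e : Fin k → ℕ) (F : Polydisc k → ClosedBallLInf),
          Function.Injective e ∧ Set.range e = N₂ ∧
          (∀ u, ⇑(F u).1 = Function.extend e u.1 (⇑z.1)) ∧
          Function.Injective (fun u => δ (F u)) ∧
          Set.range (fun u => δ (F u)) = gleasonPart (δ z) ∧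
          ∀ u v, gleasonDist (δ (F u)) (δ (F v)) =
            gleasonDist (evalChar (Fin k → ℂ) u) (evalChar (Fin k → ℂ) v)) ∧
      (N₂.Infinite →
        ∃ (e : ℕ → ℕ) (F : OpenBallLInf → ClosedBallLInf),
          Function.Injective e ∧ Set.range e = N₂ ∧
          (∀ u, ⇑(F u).1 = Function.extend e (⇑u.1) (⇑z.1)) ∧
          Function.Injective (fun u => δ (F u)) ∧
          Set.range (fun u => δ (F u)) = gleasonPart (δ z) ∧
          ∀ u v, gleasonDist (δ (F u)) (δ (F v)) =
            gleasonDist (δ u.toClosed) (δ v.toClosed))) ∧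
    -- (iv)
    (N₃.Infinite → N₂ = ∅ →
      (∀ k : ℕ,
        ∃ (e : Fin k → ℕ) (F : Polydisc k → ClosedBallLInf),
          Function.Injective e ∧ Set.range e ⊆ N₃ ∧
          (∀ u, ⇑(F u).1 = Function.extend e u.1 (⇑z.1)) ∧
          Function.Injective (fun u => δ (F u)) ∧
          Set.range (fun u => δ (F u)) ⊆ gleasonPart (δ z) ∧
          ∀ u v, gleasonDist (δ (F u)) (δ (F v)) =
            gleasonDist (evalChar (Fin k → ℂ) u) (evalChar (Fin k → ℂ) v)) ∧
      ∃ J : OpenBallLInf → SpecC0,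
        Function.Injective J ∧ Set.range J ⊆ gleasonPart (δ z) ∧
        Continuous (fun u => toDual (J u))) ∧
    -- (v)
    (N₂.Infinite → N₃.Infinite →
      ∃ (e : ℕ → ℕ) (F : OpenBallLInf → ClosedBallLInf),
        Function.Injective e ∧ Set.range e = N₂ ∧
        (∀ u, ⇑(F u).1 = Function.extend e (⇑u.1) (⇑z.1)) ∧
        Function.Injective (fun u => δ (F u)) ∧
        Set.range (fun u => δ (F u)) ⊆ gleasonPart (δ z) ∧
        ∀ u v, gleasonDist (δ (F u)) (δ (F v)) =
          gleasonDist (δ u.toClosed) (δ v.toClosed)) := by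
  refine ⟨pointEval, isPointEvaluation_pointEval, fun z => ⟨exists_isSplitting z,
    fun N₂ N₃ hS => ⟨?_, ?_, ?_, ?_, ?_⟩⟩⟩
  · rintro rfl
    obtain ⟨r, hr, hz⟩ := hS.sup_lt
    have hz1 : ‖z.1‖ < 1 := (lp.norm_le_of_forall_le ((norm_nonneg _).trans (hz 0 (mem_univ 0)))
      fun n => hz n (mem_univ n)).trans_lt hr
    refine ⟨hz1, ?_, gleasonPart_pointEval_of_norm_lt_one hz1, fun u v huv => ?_⟩
    · rw [gleasonPart_pointEval_of_norm_lt_one hz1, gleasonPart_pointEval_of_norm_lt_one]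
      rw [norm_zero]
      exact one_pos
    · exact Subtype.ext (congrArg (fun w : ClosedBallLInf => w.1) (pointEval_injective huv))
  · intro h1
    refine ⟨fun n => (h1 ▸ mem_univ n : n ∈ unimodularIdx z), ?_⟩
    -- No coordinate is free, so the description of the part leaves only `z`.
    rw [gleasonPart_pointEval (N := ∅) (by rw [h1, compl_univ]) zero_lt_one (by simp)]
    ext φ
    constructor
    · rintro ⟨w, rfl, hw, -⟩
      exact congrArg pointEval (ClosedBallLInf.ext fun n => hw n (h1 ▸ mem_univ n))
    · rintro rfl
      exact ⟨z, rfl, fun _ _ => rfl, 0, one_pos, by simp⟩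
  · intro h₃ _ _
    have hN := hS.eq_compl h₃
    obtain ⟨r, hr, hz⟩ := hS.sup_lt
    refine ⟨gleasonPart_pointEval hN hr hz, fun k hk => ?_, fun hinf => ?_⟩
    · obtain ⟨e, he, heN⟩ := Set.exists_enumeration_of_encard_eq hk
      obtain ⟨F, hF⟩ := exists_polydisc_embedding he z
      exact ⟨e, F, he, heN, hF, injective_pointEval_extend he Subtype.val_injective hF,
        range_pointEval_extend he Polydisc.norm_apply_le Polydisc.exists_of_norm_le hF hN heN hr hz,
        gleasonDist_pointEval_eq_evalChar he hF⟩
    · obtain ⟨e, he, heN⟩ := hinf.exists_enumeration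
      obtain ⟨F, hF⟩ := exists_openBall_embedding he z
      exact ⟨e, F, he, heN, hF, injective_pointEval_extend he OpenBallLInf.coe_injective hF,
        range_pointEval_extend he OpenBallLInf.norm_apply_le OpenBallLInf.exists_of_norm_le hF hN
          heN hr hz, gleasonDist_pointEval_eq he hF⟩
  · intro hinf _
    -- The whole enumeration of `N₃` serves the Lipschitz embedding, its first `k` terms the
    -- polydisc.
    obtain ⟨e, he, heN⟩ := hinf.exists_enumeration
    have hlt : ∀ j, ‖z.1 (e j)‖ ≠ 1 := fun j => by
      have h : e j ∈ (unimodularIdx z)ᶜ := by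
        rw [← hS.union]
        exact Or.inr (heN ▸ mem_range_self j)
      exact h
    refine ⟨fun k => ?_, fun u => pointEval (moveCoord he z u),
      pointEval_injective.comp (moveCoord_injective he hlt), ?_, continuous_toDual_moveCoord he z⟩
    · have he' : Function.Injective fun i : Fin k => e i := he.comp Fin.val_injective
      obtain ⟨F, hF⟩ := exists_polydisc_embedding he' z
      -- Finitely many coordinates from `N₃` stay away from the circle, although those of `N₃` as a
      -- whole do not.
      obtain ⟨r, hr, hz⟩ := exists_lt_one_forall_le (f := fun i : Fin k => ‖z.1 (e i)‖)
        fun i => lt_of_le_of_ne (z.norm_apply_le _) (hlt i)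
      refine ⟨fun i => e i, F, he', ?_, hF,
        injective_pointEval_extend he' Subtype.val_injective hF,
        range_pointEval_extend_subset he' Polydisc.norm_apply_le hF hr hz,
        gleasonDist_pointEval_eq_evalChar he' hF⟩
      rintro _ ⟨i, rfl⟩
      exact heN ▸ mem_range_self (i : ℕ)
    · rintro _ ⟨u, rfl⟩
      exact pointEval_moveCoord_mem_gleasonPart he z u
  · intro hinf _
    obtain ⟨r, hr, hz⟩ := hS.sup_lt
    obtain ⟨e, he, heN⟩ := hinf.exists_enumeration
    obtain ⟨F, hF⟩ := exists_openBall_embedding he z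
    exact ⟨e, F, he, heN, hF, injective_pointEval_extend he OpenBallLInf.coe_injective hF,
      range_pointEval_extend_subset he OpenBallLInf.norm_apply_le hF hr
        fun i => hz _ (heN ▸ mem_range_self i), gleasonDist_pointEval_eq he hF⟩

end
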